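/- \textbf{Setting.} Let $T\ge 1$, and let $\zeta(j),\theta(j)$, $j\in\mathbb Z$, be complex zero-mean sequences of finite variance on a probability space which are $T$-periodically correlated, $\mathsf E\,\zeta(n+T)\overline{\zeta(m+T)}=\mathsf E\,\zeta(n)\overline{\zeta(m)}$ (and likewise for $\theta$), and mutually uncorrelated, $\mathsf E\,\zeta(n)\overline{\theta(m)}=0$ for all $n,m$. Put $\vec\zeta(n)=(\zeta(nT+1),\dots,\zeta(nT+T))^\top$, similarly $\vec\theta(n)$, and suppose that these stationary sequences have spectral density matrices $f(\lambda)$ and $g(\lambda)$: integrable on $(-\pi,\pi]$, positive semidefinite almost everywhere, with $\mathsf E\,\zeta_\nu(n)\overline{\zeta_\mu(m)}=\frac1{2\pi}\int_{-\pi}^{\pi}e^{i(n-m)\lambda}f_{\nu\mu}(\lambda)\,d\lambda$, where $\zeta_\nu(n)=\zeta(nT+\nu)$ (and likewise for $\theta,g$). Assume the minimality condition: $f+g$ is invertible almost everywhere and $\int_{-\pi}^{\pi}\mathrm{Tr}\,(f(\lambda)+g(\lambda))^{-1}d\lambda<\infty$. Let $s\ge0$, let $N_l,K_l\ge0$ $(1\le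 l\le s)$ be integers, $M_l=\sum_{k=1}^{l}(N_k+K_k)$, $M_0=0$, and $$S=\bigcup_{l=1}^{s}\{-M_lT+1,\dots,-M_{l-1}T-N_lT\},\qquad \widetilde S=\bigcup_{l=1}^{s}\{-M_l,\dots,-M_{l-1}-N_l-1\},\qquad \Gamma=\widetilde S\cup\{0,1,2,\dots\}.$$ For given $N$ and complex coefficients $a(1),\dots,a(NT)$ consider $A_N\zeta=\sum_{j=1}^{NT}a(j)\zeta(j)=\sum_{j=0}^{N-1}\vec a^{\top}(j)\vec\zeta(j)$, where $\vec a(j)=(a(jT+1),\dots,a(jT+T))^\top$, and put $A_N(e^{i\lambda})=\sum_{j=0}^{N-1}\vec a(j)e^{ij\lambda}$. A linear estimate is an element of the closed linear span in $L^2$ of the observations $\zeta(j)+\theta(j)$, $j\in\{\dots,-2,-1,0\}\setminus S$; an optimal one minimises $\mathsf E|A_N\zeta-\widehat{A_N\zeta}|^2$. Let $L_2(f+g)$ be the space of vector functions $h$ with $\int_{-\pi}^{\pi} h^\top(f+g)\overline{h}\,d\lambda<\infty$, let $L_2^s(f+g)$ be its closed subspace generated by $e^{ij\lambda}\delta_\nu$,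 $j\in\{\dots,-2,-1\}\setminus\widetilde S$, $\nu=1,\dots,T$ ($\delta_\nu$ the standard basis vectors), and for $h\in L_2^s(f+g)$ let $$\Delta(h;f,g)=\frac1{2\pi}\int_{-\pi}^{\pi}(A_N-h)^\top f\,\overline{(A_N-h)}\,d\lambda+\frac1{2\pi}\int_{-\pi}^{\pi}h^\top g\,\overline h\,d\lambda .$$ The function $h\in L_2^s(f+g)$ is a spectral characteristic of an estimate if the estimate is the image of $h$ under the isometry of $L_2(f+g)$ into $L^2$ which extends $e^{ij\lambda}\delta_\nu\mapsto\zeta_\nu(j)+\theta_\nu(j)$, i.e. it equals $\int_{-\pi}^{\pi} h^\top(Z^{\vec\zeta}(d\lambda)+Z^{\vec\theta}(d\lambda))$, with $Z^{\vec\zeta},Z^{\vec\theta}$ the orthogonal random measures of $\vec\zeta,\vec\theta$. For $k,j\in\Gamma$ define the $T\times T$ blocks $$B(k,j)=\frac1{2\pi}\int_{-\pi}^{\pi}\big[(f+g)^{-1}\big]^{\top}e^{i(j-k)\lambda}d\lambda,\quad R(k,j)=\frac1{2\pi}\int_{-\pi}^{\pi}\big[f(f+g)^{-1}\big]^{\top}e^{i(j-k)\lambda}d\lambda,\quad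 D(k,j)=\frac1{2\pi}\int_{-\pi}^{\pi}\big[f(f+g)^{-1}g\big]^{\top}e^{i(j-k)\lambda}d\lambda .$$ Let $\mathbf a_N$ be the sequence on $\Gamma$ equal to $\vec a(j)$ for $0\le j\le N-1$ and to $0$ elsewhere; $\mathbf R_N$ is the matrix $(R(k,j))$ with the columns $j>N-1$ replaced by $0$, and $\mathbf D_N$ is the matrix $(D(k,j))$ with all entries with $k>N-1$ or $j>N-1$ replaced by $0$. Let $\mathbf B$ be the operator in $\ell^2(\Gamma;\mathbb C^T)$ defined by the block matrix $(B(k,j))_{k,j\in\Gamma}$. As this matrix may be unbounded, $\mathbf B$ is understood as the operator of its closed nonnegative form: for $c\in\ell^2(\Gamma;\mathbb C^T)$ let $C(e^{i\lambda})=\sum_{n\in\Gamma}c(n)e^{in\lambda}$ (convergence in mean square), and say that $c$ has finite energy if $\int_{-\pi}^{\pi} C^\top(f+g)^{-1}\overline C\,d\lambda<\infty$; then $\mathbf Bc=y$ means that $c$ has finite energy, $y\in\ell^2(\Gamma;\mathbb C^T)$, and $\frac1{2\pi}\int_{-\pi}^{\pi} C^\top(f+g)^{-1}\overline{E}\,d\lambda=\langle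 y,d\rangle$ for all $d$ of finite energy, $E(e^{i\lambda})=\sum_{n\in\Gamma}d(n)e^{in\lambda}$. (If the matrix is bounded in $\ell^2$, this is the bounded operator with that matrix.) Assume that $\mathbf B$ is invertible, i.e. that for each $y\in\ell^2(\Gamma;\mathbb C^T)$ there is exactly one $c$ with $\mathbf Bc=y$. \textbf{Theorem.} The sequence $\mathbf R_N\mathbf a_N$ belongs to $\ell^2(\Gamma;\mathbb C^T)$. Let $c=\mathbf B^{-1}\mathbf R_N\mathbf a_N$, $C(e^{i\lambda})=\sum_{n\in\Gamma}c(n)e^{in\lambda}$ and $$h_N^{\top}(e^{i\lambda})=\big(A_N^{\top}(e^{i\lambda})f(\lambda)-C^{\top}(e^{i\lambda})\big)\,[f(\lambda)+g(\lambda)]^{-1}.$$ Then $h_N\in L_2^s(f+g)$, and $h_N$ minimises $\Delta(h;f,g)$ over $h\in L_2^s(f+g)$. An optimal linear estimate $\widehat{A_N\zeta}$ of $A_N\zeta$ exists, its spectral characteristic is $h_N$, uniquely up to equality almost everywhere, and its mean-square error is $$\mathsf E\big|A_N\zeta-\widehat{A_N\zeta}\big|^2=\Delta(h_N;f,g)=\langle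 \mathbf D_N\mathbf a_N,\mathbf a_N\rangle+\langle\mathbf Bc,c\rangle .$$ -/

import Mathlib

open MeasureTheory Filter Topology
open scoped ENNReal Matrix ComplexOrder

namespace PCExtrapolation

/-- Normalised Lebesgue measure on the circle: integration against it is `(1/2π) ∫_{-π}^{π} … dλ`. -/
noncomputable def circ : Measure ℝ :=
  ENNReal.ofReal (1 / (2 * Real.pi)) • volume.restrict (Set.Ioc (-Real.pi) Real.pi)

/-- The exponential `e^{i n λ}`. -/
noncomputable def expi (n : ℤ) (l : ℝ) : ℂ := Complex.exp (Complex.I * (n : ℂ) * (l : ℂ))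

/-! ### Periodically correlated sequences, blocking, spectral densities -/

/-- A zero-mean sequence of finite variance whose covariance function is `T`-periodic:
`E ζ(n+T) conj ζ(m+T) = E ζ(n) conj ζ(m)`. (That `T` is the least period is not required.) -/
structure IsPC {Ω : Type*} [MeasurableSpace Ω] (P : Measure Ω) (T : ℕ) (ζ : ℤ → Ω → ℂ) : Prop where
  memLp : ∀ n, MemLp (ζ n) 2 P
  mean_zero : ∀ n, ∫ ω, ζ n ω ∂P = 0
  periodic : ∀ n m : ℤ,
    ∫ ω, ζ (n + T) ω * star (ζ (m + T) ω) ∂P = ∫ ω, ζ n ω * star (ζ m ω) ∂P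

/-- Two sequences are uncorrelated: `E ζ(n) conj θ(m) = 0` for all `n`, `m`. -/
def Uncorrelated {Ω : Type*} [MeasurableSpace Ω] (P : Measure Ω) (ζ θ : ℤ → Ω → ℂ) : Prop :=
  ∀ n m : ℤ, ∫ ω, ζ n ω * star (θ m ω) ∂P = 0

/-- `T`-blocking: the components `ζ(nT + 1), …, ζ(nT + T)` of the vector at time `n`
(the index `ν : Fin T` starts at `0`). -/
def block {Ω : Type*} (T : ℕ) (ζ : ℤ → Ω → ℂ) (n : ℤ) (ν : Fin T) : Ω → ℂ :=
  ζ (n * T + (ν : ℤ) + 1)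

/-- `f` is the spectral density matrix of the `T`-variate stationary sequence obtained from `ζ`
by `T`-blocking. -/
structure IsSpectralDensity {Ω : Type*} [MeasurableSpace Ω] (P : Measure Ω) (T : ℕ)
    (ζ : ℤ → Ω → ℂ) (f : ℝ → Matrix (Fin T) (Fin T) ℂ) : Prop where
  posSemidef : ∀ᵐ l ∂circ, (f l).PosSemidef
  integrable : ∀ ν μ, Integrable (fun l => f l ν μ) circ
  covariance : ∀ (n m : ℤ) (ν μ : Fin T),
    ∫ ω, block T ζ n ν ω * star (block T ζ m μ ω) ∂P = ∫ l, expi (n - m) l * f l ν μ ∂circ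

/-- The minimality condition: `f + g` is invertible almost everywhere and
`∫ Tr (f + g)⁻¹ dλ < ∞`. -/
def Minimality {T : ℕ} (f g : ℝ → Matrix (Fin T) (Fin T) ℂ) : Prop :=
  (∀ᵐ l ∂circ, IsUnit (f l + g l).det) ∧
    Integrable (fun l => ((f l + g l)⁻¹).trace) circ

/-! ### The pattern of observations -/

/-- `M_l = ∑_{k=1}^{l} (N_k + K_k)`. -/
def gapM (Nobs Kmis : ℕ → ℕ) (l : ℕ) : ℕ := ∑ k ∈ Finset.Icc 1 l, (Nobs k + Kmis k)

/-- The missing times `S = ⋃_{l=1}^{s} {-M_l T + 1, …, -M_{l-1} T - N_l T}`. -/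
def missing (T s : ℕ) (Nobs Kmis : ℕ → ℕ) : Set ℤ :=
  ⋃ l ∈ Finset.Icc 1 s,
    Set.Icc (-(gapM Nobs Kmis l : ℤ) * T + 1)
      (-(gapM Nobs Kmis (l - 1) : ℤ) * T - (Nobs l : ℤ) * T)

/-- The observed times `{…, -1, 0} \ S`. -/
def observed (T s : ℕ) (Nobs Kmis : ℕ → ℕ) : Set ℤ := Set.Iic 0 \ missing T s Nobs Kmis

/-- The missing blocks `S̃ = ⋃_{l=1}^{s} {-M_l, …, -M_{l-1} - N_l - 1}`. -/
def missingBlocks (s : ℕ) (Nobs Kmis : ℕ → ℕ) : Set ℤ :=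
  ⋃ l ∈ Finset.Icc 1 s,
    Set.Icc (-(gapM Nobs Kmis l : ℤ)) (-(gapM Nobs Kmis (l - 1) : ℤ) - (Nobs l : ℤ) - 1)

/-- The observed blocks `{…, -2, -1} \ S̃`. -/
def observedBlocks (s : ℕ) (Nobs Kmis : ℕ → ℕ) : Set ℤ :=
  Set.Iic (-1) \ missingBlocks s Nobs Kmis

/-- `Γ = S̃ ∪ {0, 1, 2, …}`. -/
def Gam (s : ℕ) (Nobs Kmis : ℕ → ℕ) : Set ℤ := missingBlocks s Nobs Kmis ∪ Set.Ici 0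

/-! ### The functional, linear estimates, the optimal estimate -/

/-- `A_N ζ = ∑_{j=1}^{NT} a(j) ζ(j)`. -/
def functional {Ω : Type*} (T N : ℕ) (a : ℕ → ℂ) (ζ : ℤ → Ω → ℂ) (ω : Ω) : ℂ :=
  ∑ j ∈ Finset.Icc 1 (N * T), a j * ζ (j : ℤ) ω

/-- `X` is a linear estimate: it lies in the closed linear span, in `L²(P)`, of the observations
`ζ(j) + θ(j)`, `j ∈ O`. -/
def IsLinearEstimate {Ω : Type*} [MeasurableSpace Ω] (P : Measure Ω) (ζ θ : ℤ → Ω → ℂ)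
    (O : Set ℤ) (X : Ω → ℂ) : Prop :=
  MemLp X 2 P ∧ ∀ ε : ℝ≥0∞, 0 < ε → ∃ p : ℤ →₀ ℂ, (p.support : Set ℤ) ⊆ O ∧
    eLpNorm (fun ω => X ω - ∑ j ∈ p.support, p j * (ζ j ω + θ j ω)) 2 P ≤ ε

/-- `X` is an optimal linear estimate of `Y`: it minimises the mean-square error among all
linear estimates. -/
def IsOptimalEstimate {Ω : Type*} [MeasurableSpace Ω] (P : Measure Ω) (ζ θ : ℤ → Ω → ℂ)
    (O : Set ℤ) (Y X : Ω → ℂ) : Prop :=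
  IsLinearEstimate P ζ θ O X ∧ ∀ X', IsLinearEstimate P ζ θ O X' →
    ∫ ω, ‖Y ω - X ω‖ ^ 2 ∂P ≤ ∫ ω, ‖Y ω - X' ω‖ ^ 2 ∂P

/-! ### The spaces `L₂(F)`, `L₂ˢ(F)` and spectral characteristics -/

/-- The squared norm `(1/2π) ∫ uᵀ F ū dλ` of `L₂(F)`, with values in `[0, ∞]`. -/
noncomputable def energy {T : ℕ} (F : ℝ → Matrix (Fin T) (Fin T) ℂ) (u : ℝ → Fin T → ℂ) : ℝ≥0∞ :=
  ∫⁻ l, ENNReal.ofReal (u l ⬝ᵥ (F l *ᵥ star (u l))).re ∂circ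

/-- The vector trigonometric polynomial `∑_j p(j) e^{ijλ}`. -/
noncomputable def trigPoly {T : ℕ} (p : ℤ →₀ (Fin T → ℂ)) (l : ℝ) (ν : Fin T) : ℂ :=
  ∑ j ∈ p.support, p j ν * expi j l

/-- The random variable `∑_j p(j)ᵀ (ζ⃗(j) + θ⃗(j))` with spectral characteristic `trigPoly p`. -/
noncomputable def randPoly {Ω : Type*} {T : ℕ} (ζ θ : ℤ → Ω → ℂ) (p : ℤ →₀ (Fin T → ℂ)) (ω : Ω) : ℂ :=
  ∑ j ∈ p.support, ∑ ν, p j ν * (block T ζ j ν ω + block T θ j ν ω)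

/-- `h ∈ L₂ˢ(F)`: `h` lies in the closure in `L₂(F)` of the span of `e^{ijλ} δ_ν`, `j ∈ O`. -/
def MemL2s {T : ℕ} (F : ℝ → Matrix (Fin T) (Fin T) ℂ) (O : Set ℤ) (h : ℝ → Fin T → ℂ) : Prop :=
  (∀ ν, AEStronglyMeasurable (fun l => h l ν) circ) ∧
    ∀ ε : ℝ≥0∞, 0 < ε → ∃ p : ℤ →₀ (Fin T → ℂ), (p.support : Set ℤ) ⊆ O ∧
      energy F (fun l => h l - trigPoly p l) ≤ ε

/-- `X = ∫ hᵀ (Z^ζ(dλ) + Z^θ(dλ))`. The stochastic integral is the continuous extension of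
`e^{ijλ} δ_ν ↦ ζ_ν(j) + θ_ν(j)` from trigonometric polynomials to `L₂(F)`, where `F` is the
spectral density of `ζ⃗ + θ⃗`. -/
def IsStochIntegral {Ω : Type*} [MeasurableSpace Ω] (P : Measure Ω) {T : ℕ} (ζ θ : ℤ → Ω → ℂ)
    (F : ℝ → Matrix (Fin T) (Fin T) ℂ) (h : ℝ → Fin T → ℂ) (X : Ω → ℂ) : Prop :=
  MemLp X 2 P ∧ ∀ ε : ℝ≥0∞, 0 < ε → ∃ p : ℤ →₀ (Fin T → ℂ),
    energy F (fun l => h l - trigPoly p l) ≤ ε ∧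
      eLpNorm (fun ω => X ω - randPoly ζ θ p ω) 2 P ≤ ε

/-- `h` is a spectral characteristic of the estimate `X`. -/
def IsSpectralCharacteristic {Ω : Type*} [MeasurableSpace Ω] (P : Measure Ω) {T : ℕ}
    (ζ θ : ℤ → Ω → ℂ) (F : ℝ → Matrix (Fin T) (Fin T) ℂ) (O : Set ℤ)
    (h : ℝ → Fin T → ℂ) (X : Ω → ℂ) : Prop :=
  MemL2s F O h ∧ IsStochIntegral P ζ θ F h X

/-- The coefficient vectors `a⃗(j)`, with components `a(jT + 1), …, a(jT + T)`. -/
def avec (T : ℕ) (a : ℕ → ℂ) (j : ℕ) (ν : Fin T) : ℂ := a (j * T + ν + 1)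

/-- `A_N(e^{iλ}) = ∑_{j=0}^{N-1} a⃗(j) e^{ijλ}`. -/
noncomputable def AN (T N : ℕ) (a : ℕ → ℂ) (l : ℝ) (ν : Fin T) : ℂ :=
  ∑ j ∈ Finset.range N, avec T a j ν * expi j l

/-- The mean-square error `Δ(h; f, g)` in the spectral domain,
`(1/2π) ∫ (A - h)ᵀ f conj(A - h) dλ + (1/2π) ∫ hᵀ g h̄ dλ`. -/
noncomputable def mse {T : ℕ} (f g : ℝ → Matrix (Fin T) (Fin T) ℂ) (A h : ℝ → Fin T → ℂ) : ℝ :=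
  (∫ l, ((A l - h l) ⬝ᵥ (f l *ᵥ star (A l - h l))).re ∂circ) +
    ∫ l, (h l ⬝ᵥ (g l *ᵥ star (h l))).re ∂circ

/-! ### The operators `B`, `R_N`, `D_N` -/

/-- The block `(1/2π) ∫ Φ(λ)ᵀ e^{i(j-k)λ} dλ` in position `(k, j)` of the block matrix with
symbol `Φ`. The transpose is there because the blocks act on column vectors. -/
noncomputable def fourierBlock {T : ℕ} (Φ : ℝ → Matrix (Fin T) (Fin T) ℂ) (k j : ℤ) :
    Matrix (Fin T) (Fin T) ℂ :=
  Matrix.of fun ν μ => ∫ l, Φ l μ ν * expi (j - k) l ∂circ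

/-- Blocks of `B`: symbol `(f + g)⁻¹`. -/
noncomputable def Bblock {T : ℕ} (f g : ℝ → Matrix (Fin T) (Fin T) ℂ) :
    ℤ → ℤ → Matrix (Fin T) (Fin T) ℂ :=
  fourierBlock fun l => (f l + g l)⁻¹

/-- Blocks of `R`: symbol `f (f + g)⁻¹`. -/
noncomputable def Rblock {T : ℕ} (f g : ℝ → Matrix (Fin T) (Fin T) ℂ) :
    ℤ → ℤ → Matrix (Fin T) (Fin T) ℂ :=
  fourierBlock fun l => f l * (f l + g l)⁻¹

/-- Blocks of `D`: symbol `f (f + g)⁻¹ g`. -/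
noncomputable def Dblock {T : ℕ} (f g : ℝ → Matrix (Fin T) (Fin T) ℂ) :
    ℤ → ℤ → Matrix (Fin T) (Fin T) ℂ :=
  fourierBlock fun l => f l * (f l + g l)⁻¹ * g l

/-- The entry `(R_N a_N)(k) = ∑_{j=0}^{N-1} R(k, j) a⃗(j)`; `a_N` vanishes off `{0, …, N-1}` and
so do the columns of `R_N` beyond `N - 1`. -/
noncomputable def RNaN {T : ℕ} (f g : ℝ → Matrix (Fin T) (Fin T) ℂ) (N : ℕ) (a : ℕ → ℂ) (k : ℤ) :
    Fin T → ℂ :=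
  ∑ j ∈ Finset.range N, Rblock f g k j *ᵥ avec T a j

/-- `⟨D_N a_N, a_N⟩ = ∑_{k, j = 0}^{N-1} ⟨D(k, j) a⃗(j), a⃗(k)⟩`. -/
noncomputable def DNform {T : ℕ} (f g : ℝ → Matrix (Fin T) (Fin T) ℂ) (N : ℕ) (a : ℕ → ℂ) : ℂ :=
  ∑ k ∈ Finset.range N, ∑ j ∈ Finset.range N,
    (Dblock f g k j *ᵥ avec T a j) ⬝ᵥ star (avec T a k)

/-- The Hilbert space `ℓ²(G; ℂ^T)` of square-summable sequences of vectors indexed by `G`. -/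
abbrev Seq2 (T : ℕ) (G : Set ℤ) : Type := lp (fun _ : G => EuclideanSpace ℂ (Fin T)) 2

/-- `C(e^{iλ}) = ∑_{n ∈ G} c(n) e^{inλ}`, with convergence in mean square. -/
def IsSeries {T : ℕ} {G : Set ℤ} (c : Seq2 T G) (C : ℝ → Fin T → ℂ) : Prop :=
  ∀ ν, MemLp (fun l => C l ν) 2 circ ∧
    Tendsto (fun t : Finset G =>
      eLpNorm (fun l => C l ν - ∑ n ∈ t, c n ν * expi n l) 2 circ) atTop (𝓝 0)

/-- The sesquilinear form `(1/2π) ∫ Cᵀ (f + g)⁻¹ D̄ dλ` of the block matrix `B`; on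
trigonometric polynomials it is `∑_{k, j} ⟨B(k, j) c(j), d(k)⟩` (see `Bform_trigPoly`). -/
noncomputable def Bform {T : ℕ} (f g : ℝ → Matrix (Fin T) (Fin T) ℂ) (C D : ℝ → Fin T → ℂ) : ℂ :=
  ∫ l, C l ⬝ᵥ ((f l + g l)⁻¹ *ᵥ star (D l)) ∂circ

theorem integrable_mul_expi {u : ℝ → ℂ} (hu : Integrable u circ) (n : ℤ) :
    Integrable (fun l => u l * expi n l) circ := by
  refine hu.mul_bdd (c := 1) ?_ ?_
  · have : Continuous (expi n) := by unfold expi; fun_prop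
    exact this.aestronglyMeasurable
  · refine Eventually.of_forall fun l => ?_
    have : Complex.I * (n : ℂ) * (l : ℂ) = ((n * l : ℝ) : ℂ) * Complex.I := by push_cast; ring
    rw [expi, this, Complex.norm_exp_ofReal_mul_I]

theorem expi_mul_star (j k : ℤ) (l : ℝ) : expi j l * star (expi k l) = expi (j - k) l := by
  have : (star (expi k l) : ℂ) = Complex.exp (-(Complex.I * k * l)) := by
    simp [expi, ← Complex.exp_conj]
  rw [this, expi, expi, ← Complex.exp_add]
  congr 1
  push_cast
  ring

theorem Bform_trigPoly {T : ℕ} (f g : ℝ → Matrix (Fin T) (Fin T) ℂ)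
    (hint : ∀ ν μ, Integrable (fun l => (f l + g l)⁻¹ ν μ) circ) (c d : ℤ →₀ (Fin T → ℂ)) :
    Bform f g (trigPoly c) (trigPoly d) =
      ∑ k ∈ d.support, ∑ j ∈ c.support, (Bblock f g k j *ᵥ c j) ⬝ᵥ star (d k) := by
  have h1 : ∀ l, trigPoly c l ⬝ᵥ ((f l + g l)⁻¹ *ᵥ star (trigPoly d l)) =
      ∑ k ∈ d.support, ∑ j ∈ c.support, ∑ μ, ∑ ν,
        (c j ν * star (d k μ)) * ((f l + g l)⁻¹ ν μ * expi (j - k) l) := by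
    intro l
    have h2 : trigPoly c l ⬝ᵥ ((f l + g l)⁻¹ *ᵥ star (trigPoly d l)) =
        ∑ ν, ∑ μ, ∑ k ∈ d.support, ∑ j ∈ c.support,
          (c j ν * star (d k μ)) * ((f l + g l)⁻¹ ν μ * expi (j - k) l) := by
      simp only [dotProduct, Matrix.mulVec, Finset.mul_sum]
      refine Finset.sum_congr rfl fun ν _ => Finset.sum_congr rfl fun μ _ => ?_
      simp only [trigPoly, Pi.star_apply, star_sum, star_mul', Finset.sum_mul, Finset.mul_sum,
        ← expi_mul_star]
      refine Finset.sum_congr rfl fun k _ => Finset.sum_congr rfl fun j _ => ?_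
      ring
    rw [h2, Finset.sum_comm]
    simp_rw [Finset.sum_comm (s := (Finset.univ : Finset (Fin T))) (t := d.support)]
    refine Finset.sum_congr rfl fun k _ => ?_
    simp_rw [Finset.sum_comm (s := (Finset.univ : Finset (Fin T))) (t := c.support)]
  unfold Bform
  simp_rw [h1]
  have hi : ∀ (k j : ℤ) (μ ν : Fin T), Integrable (fun l =>
      (c j ν * star (d k μ)) * ((f l + g l)⁻¹ ν μ * expi (j - k) l)) circ :=
    fun k j μ ν => (integrable_mul_expi (hint ν μ) (j - k)).const_mul _
  rw [integral_finsetSum _ fun k _ => integrable_finsetSum _ fun j _ =>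
    integrable_finsetSum _ fun μ _ => integrable_finsetSum _ fun ν _ => hi k j μ ν]
  refine Finset.sum_congr rfl fun k _ => ?_
  rw [integral_finsetSum _ fun j _ =>
    integrable_finsetSum _ fun μ _ => integrable_finsetSum _ fun ν _ => hi k j μ ν]
  refine Finset.sum_congr rfl fun j _ => ?_
  rw [integral_finsetSum _ fun μ _ => integrable_finsetSum _ fun ν _ => hi k j μ ν]
  refine Finset.sum_congr rfl fun μ _ => ?_
  rw [integral_finsetSum _ fun ν _ => hi k j μ ν, Matrix.mulVec, dotProduct, Finset.sum_mul]
  refine Finset.sum_congr rfl fun ν _ => ?_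
  rw [integral_const_mul]
  simp only [Bblock, fourierBlock, Matrix.of_apply, Pi.star_apply]
  ring

/-- The graph of the linear operator `B` in `ℓ²(G; ℂ^T)` defined by the block matrix
`(Bblock f g k j)`, `k, j ∈ G`. Under the minimality condition the symbol `(f + g)⁻¹` is only
integrable, so the matrix may be unbounded in `ℓ²`; `B` is then the self-adjoint operator of the
closed nonnegative form of the matrix: `y = B c` means that `c` has finite energy and
`⟨y, d⟩ = ⟨B c, d⟩` for every `d` of finite energy. If the matrix is bounded in `ℓ²`, every `d`
has finite energy and `B` is the bounded operator with that matrix. -/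
def Bgraph {T : ℕ} (f g : ℝ → Matrix (Fin T) (Fin T) ℂ) (G : Set ℤ) :
    Set (Seq2 T G × Seq2 T G) :=
  {q | ∃ C, IsSeries q.1 C ∧ energy (fun l => (f l + g l)⁻¹) C < ∞ ∧
    ∀ d D, IsSeries d D → energy (fun l => (f l + g l)⁻¹) D < ∞ →
      Bform f g C D = inner ℂ d q.2}

/-- `B` acts by its block matrix: `(B c)(k)` is the `k`-th Fourier coefficient of `Cᵀ (f + g)⁻¹`,
that is, `∑_j B(k, j) c(j)`. -/
theorem Bgraph_apply {T : ℕ} {f g : ℝ → Matrix (Fin T) (Fin T) ℂ} {G : Set ℤ}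
    (hint : ∀ ν μ, Integrable (fun l => (f l + g l)⁻¹ ν μ) circ)
    {c y : Seq2 T G} (h : (c, y) ∈ Bgraph f g G) :
    ∃ C, IsSeries c C ∧ ∀ (k : G) (ν : Fin T),
      y k ν = ∫ l, (C l ᵥ* (f l + g l)⁻¹) ν * expi (-k) l ∂circ := by
  classical
  obtain ⟨C, hC, -, hq⟩ := h
  refine ⟨C, hC, fun k ν => ?_⟩
  let d : Seq2 T G := lp.single 2 k (EuclideanSpace.single ν (1 : ℂ))
  let D : ℝ → Fin T → ℂ := fun l => Pi.single ν (expi k l)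
  have hstar : ∀ l, star (D l) = Pi.single ν (expi (-k) l) := by
    intro l
    have : star (expi k l) = expi (-k) l := by
      have := expi_mul_star 0 k l
      simpa [expi] using this
    ext μ
    by_cases hμ : μ = ν
    · subst hμ; simp [D, this]
    · simp [D, hμ]
  have hfin : IsFiniteMeasure circ := by
    exact Measure.smul_finite _ ENNReal.ofReal_ne_top
  have hD : IsSeries d D := by
    intro μ
    have hcont : Continuous (expi k) := by unfold expi; fun_prop
    constructor
    · refine MemLp.of_bound (C := 1) ?_ (Eventually.of_forall fun l => ?_)
      · by_cases hμ : μ = ν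
        · subst hμ; simpa [D] using hcont.aestronglyMeasurable
        · simp [D, hμ, aestronglyMeasurable_const]
      · by_cases hμ : μ = ν
        · subst hμ
          have : Complex.I * ((k : ℤ) : ℂ) * (l : ℂ) = (((k : ℤ) * l : ℝ) : ℂ) * Complex.I := by
            push_cast; ring
          simp only [D, Pi.single_eq_same]
          rw [expi, this, Complex.norm_exp_ofReal_mul_I]
        · simp [D, hμ]
    · refine tendsto_const_nhds.congr' ?_
      filter_upwards [eventually_ge_atTop ({k} : Finset G)] with t ht
      have hk : k ∈ t := ht (Finset.mem_singleton_self k)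
      have : (fun l => D l μ - ∑ n ∈ t, d n μ * expi n l) = 0 := by
        funext l
        rw [Finset.sum_eq_single_of_mem k hk]
        · by_cases hμ : μ = ν
          · subst hμ; simp [D, d]
          · simp [D, d, hμ]
        · intro n _ hn
          simp [d, hn]
      rw [this]; simp
  have hE : energy (fun l => (f l + g l)⁻¹) D < ∞ := by
    unfold energy
    refine lt_of_le_of_lt (lintegral_mono fun l => ?_) (hint ν ν).2
    rw [hstar, ← ofReal_norm]
    refine ENNReal.ofReal_le_ofReal ((Complex.re_le_norm _).trans (le_of_eq ?_))
    have hn : ∀ n : ℤ, ‖expi n l‖ = 1 := fun n => by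
      have : Complex.I * (n : ℂ) * (l : ℂ) = ((n * l : ℝ) : ℂ) * Complex.I := by push_cast; ring
      rw [expi, this, Complex.norm_exp_ofReal_mul_I]
    simp [D, hn]
  have key := hq d D hD hE
  have h1 : inner ℂ d y = y k ν := by
    simp [d, lp.inner_single_left, EuclideanSpace.inner_single_left]
  rw [← h1, ← key, Bform]
  refine integral_congr_ae (Eventually.of_forall fun l => ?_)
  simp only [hstar]
  rw [Matrix.dotProduct_mulVec]
  simp

/-- `B` is invertible: for every `y` in `ℓ²(G; ℂ^T)` there is exactly one `c` with `B c = y`. -/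
def BInvertible {T : ℕ} (f g : ℝ → Matrix (Fin T) (Fin T) ℂ) (G : Set ℤ) : Prop :=
  ∀ y : Seq2 T G, ∃! c : Seq2 T G, (c, y) ∈ Bgraph f g G

/-- `h_Nᵀ = (A_Nᵀ f - Cᵀ) (f + g)⁻¹`. -/
noncomputable def hN {T : ℕ} (f g : ℝ → Matrix (Fin T) (Fin T) ℂ) (N : ℕ) (a : ℕ → ℂ)
    (C : ℝ → Fin T → ℂ) (l : ℝ) : Fin T → ℂ :=
  (AN T N a l ᵥ* f l - C l) ᵥ* (f l + g l)⁻¹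

end PCExtrapolation

open PCExtrapolation

/-!
Write `F = f + g`. Completing the square shows that, for every `h` in `L₂(F)`, the error
`Δ(h; f, g)` is `‖h - u‖² + ⟨D_N a_N, a_N⟩`, where `uᵀ = A_Nᵀ f F⁻¹` and the norm is that of `L₂(F)`
(`IsDensityPair.mse_eq`). So the minimiser over `L₂ˢ(F)` is the projection of `u`, and the proof
shows that this projection is `h_N = u - C F⁻¹`.

The difference `u - h_N = C F⁻¹` is orthogonal to `e^{ijλ} δ_ν` for `j ∉ Γ`, because its product
with `F` is `C`, whose Fourier coefficients vanish off `Γ` (`IsDensityPair.inner_expEmb_series`).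
Conversely, let `w` in `L₂(F)` be orthogonal to all these exponentials. Then `wᵀ F` has finite
energy and vanishing Fourier coefficients off `Γ`. Once it is known to be square integrable it is a
series over `Γ`, against which `B c = R_N a_N` may be tested, and this says `⟨h_N, w⟩ = 0`. Hence
`h_N` lies in the double orthogonal complement `L₂ˢ(F)` (`IsDensityPair.toLp_emb_hN_mem`).

What makes this work is that invertibility of `B` forces `F` to be essentially bounded
(`exists_norm_vecMul_root_le`). The inverse of `B` is symmetric and everywhere defined, hence
bounded by the Hellinger–Toeplitz theorem, so the form of `B` is bounded below
(`exists_norm_sq_le_energy`). As `Γ` contains all nonnegative integers, every trigonometric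
polynomial can be shifted into the span over `Γ`, so the same bound holds for all of them, and by
density it is a pointwise lower bound for `F⁻¹`. Boundedness of `F` gives that `wᵀ F` is square
integrable for `w` in `L₂(F)` (`IsDensityPair.memLp_vecMul`) and, together with integrability of
`F⁻¹`, that `u` is square integrable (`IsDensityPair.memLp_wiener`); the sequence `R_N a_N` of its
Fourier coefficients is therefore in `ℓ²`.

Hilbert space arguments in `L₂(F)` are carried out in the unweighted `L²`, through the isometry
`u ↦ uᵀ F^{1/2}` (`emb`), which is onto. Finally, the exponentials in `L₂(F)` and the observations
`ζ_ν(j) + θ_ν(j)` in `L²(P)` have the same Gram matrix, and they pair in the same way with `u` and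
with `A_N ζ` (`inner_obs`, `inner_obs_functional`), so the projection of `u` is carried to the
projection of `A_N ζ` (`exists_transfer`), which is the optimal estimate.
-/

namespace PCExtrapolation

/-! ### Fourier analysis on the circle -/

instance : IsFiniteMeasure circ := Measure.smul_finite _ ENNReal.ofReal_ne_top

instance : Fact (0 < 2 * Real.pi) := ⟨Real.two_pi_pos⟩

theorem continuous_expi (n : ℤ) : Continuous (expi n) := by unfold expi; fun_prop

theorem norm_expi (n : ℤ) (l : ℝ) : ‖expi n l‖ = 1 := by
  have : Complex.I * (n : ℂ) * (l : ℂ) = ((n * l : ℝ) : ℂ) * Complex.I := by push_cast; ring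
  rw [expi, this, Complex.norm_exp_ofReal_mul_I]

theorem star_expi (n : ℤ) (l : ℝ) : star (expi n l) = expi (-n) l := by
  simpa [expi] using expi_mul_star 0 n l

theorem expi_add (j k : ℤ) (l : ℝ) : expi (j + k) l = expi j l * expi k l := by
  rw [expi, expi, expi, ← Complex.exp_add]; congr 1; push_cast; ring

theorem fourier_coe_eq_expi (n : ℤ) (l : ℝ) :
    fourier n (l : AddCircle (2 * Real.pi)) = expi n l := by
  rw [fourier_coe_apply, expi]
  congr 1
  have : (Real.pi : ℂ) ≠ 0 := by exact_mod_cast Real.pi_ne_zero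
  push_cast
  field_simp

/-- Trigonometric polynomials are dense in `L²(μ)` for every finite measure `μ` on `(-π, π]`:
by Stone–Weierstrass on the circle, to which `μ` is transported. -/
theorem exists_trigPoly_approx {μ : Measure ℝ} [IsFiniteMeasure μ]
    (hμ : μ (Set.Ioc (-Real.pi) Real.pi)ᶜ = 0) {φ : ℝ → ℂ} (hφ : MemLp φ 2 μ) {ε : ℝ≥0∞}
    (hε : ε ≠ 0) :
    ∃ p : ℤ →₀ ℂ, eLpNorm (fun l => φ l - ∑ j ∈ p.support, p j * expi j l) 2 μ ≤ ε := by
  let mk : ℝ → AddCircle (2 * Real.pi) := fun l => (l : AddCircle (2 * Real.pi))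
  have hmk : Measurable mk := AddCircle.measurable_mk'
  let ν := μ.map mk
  have : IsFiniteMeasure ν := Measure.isFiniteMeasure_map μ mk
  let r : AddCircle (2 * Real.pi) → ℝ :=
    fun x => (AddCircle.measurableEquivIoc (2 * Real.pi) (-Real.pi) x : ℝ)
  have hr : Measurable r := measurable_subtype_coe.comp (MeasurableEquiv.measurable _)
  have hpi : -Real.pi + 2 * Real.pi = Real.pi := by ring
  have hrmk : ∀ᵐ l ∂μ, r (mk l) = l := by
    refine (ae_iff.2 ?_ : ∀ᵐ l ∂μ, l ∈ Set.Ioc (-Real.pi) Real.pi).mono fun l hl => ?_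
    · exact hμ
    · have hl' : l ∈ Set.Ioc (-Real.pi) (-Real.pi + 2 * Real.pi) := by rwa [hpi]
      have := (AddCircle.measurableEquivIoc (2 * Real.pi) (-Real.pi)).apply_symm_apply ⟨l, hl'⟩
      exact congrArg Subtype.val this
  have hmap : ν.map r = μ := by
    rw [Measure.map_map hr hmk, Measure.map_congr (show r ∘ mk =ᵐ[μ] id from hrmk), Measure.map_id]
  have hφν : MemLp (φ ∘ r) 2 ν := by
    refine MemLp.comp_of_map (by rwa [hmap]) hr.aemeasurable
  have hd := (ContinuousMap.toLp_denseRange (p := 2) ℂ ν ℂ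
    ENNReal.ofNat_ne_top).topologicalClosure_map_submodule
      (span_fourier_closure_eq_top (T := 2 * Real.pi))
  have hmem : hφν.toLp ∈ closure ((Submodule.map (ContinuousMap.toLp 2 ν ℂ :
      C(AddCircle (2 * Real.pi), ℂ) →L[ℂ] Lp ℂ 2 ν).toLinearMap
      (Submodule.span ℂ (Set.range (@fourier (2 * Real.pi)))) : Submodule ℂ (Lp ℂ 2 ν)) :
        Set (Lp ℂ 2 ν)) := by
    rw [← Submodule.topologicalClosure_coe]
    change _ ∈ Submodule.topologicalClosure _
    erw [hd]; trivial
  obtain ⟨y, hy, hyd⟩ := EMetric.mem_closure_iff.1 hmem ε (pos_iff_ne_zero.2 hε)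
  obtain ⟨q, hq, rfl⟩ := Submodule.mem_map.1 hy
  obtain ⟨p, rfl⟩ := (Finsupp.mem_span_range_iff_exists_finsupp).1 hq
  refine ⟨p, le_trans (le_of_eq ?_) hyd.le⟩
  rw [Lp.edist_def]
  have h1 : (fun x => φ (r x) - ∑ j ∈ p.support, p j * fourier j x) =ᵐ[ν]
      (hφν.toLp - (ContinuousMap.toLp 2 ν ℂ (p.sum fun i a => a • fourier i) : Lp ℂ 2 ν) :
        AddCircle (2 * Real.pi) → ℂ) := by
    filter_upwards [hφν.coeFn_toLp, ContinuousMap.coeFn_toLp (p := 2) (𝕜 := ℂ) ν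
      (p.sum fun i a => a • fourier i)] with x h1 h2
    simp only [Pi.sub_apply]
    rw [h1, h2, Finsupp.sum, ContinuousMap.coe_sum]
    simp
  rw [← ContinuousLinearMap.coe_coe] at h1
  refine Eq.trans ?_ (eLpNorm_congr_ae h1)
  rw [eLpNorm_map_measure ?_ hmk.aemeasurable]
  · refine eLpNorm_congr_ae ?_
    filter_upwards [hrmk] with l hl
    simp only [Function.comp, hl, mk, fourier_coe_eq_expi]
  · exact hφν.1.sub (by fun_prop)

theorem circ_compl : circ (Set.Ioc (-Real.pi) Real.pi)ᶜ = 0 := by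
  simp [circ, Measure.restrict_apply' measurableSet_Ioc]

theorem memLp_expi {μ : Measure ℝ} [IsFiniteMeasure μ] (n : ℤ) (p : ℝ≥0∞) : MemLp (expi n) p μ :=
  MemLp.of_bound (C := 1) (continuous_expi n).aestronglyMeasurable
    (Eventually.of_forall fun l => (norm_expi n l).le)

theorem integral_circ (u : ℝ → ℂ) :
    ∫ l, u l ∂circ = (1 / (2 * Real.pi) : ℝ) • ∫ l in -Real.pi..Real.pi, u l := by
  rw [circ, integral_smul_measure, intervalIntegral.integral_of_le (by linarith [Real.pi_pos]),
    ENNReal.toReal_ofReal (by positivity)]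

theorem integral_expi (n : ℤ) : ∫ l, expi n l ∂circ = if n = 0 then 1 else 0 := by
  rw [integral_circ]
  have hpi : (Real.pi : ℂ) ≠ 0 := by exact_mod_cast Real.pi_ne_zero
  split_ifs with h
  · subst h
    simp only [expi, Int.cast_zero, mul_zero, zero_mul, Complex.exp_zero,
      intervalIntegral.integral_const, sub_neg_eq_add, smul_smul]
    have : (1 / (2 * Real.pi) * (Real.pi + Real.pi) : ℝ) = 1 := by
      field_simp [Real.pi_ne_zero]; norm_num
    rw [this, one_smul]
  · have hc : Complex.I * (n : ℂ) ≠ 0 := by simp [h]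
    have h2 : Complex.exp (Complex.I * n * Real.pi) =
        Complex.exp (Complex.I * n * ((-Real.pi : ℝ) : ℂ)) := by
      rw [Complex.exp_eq_exp_iff_exists_int]
      exact ⟨n, by push_cast; ring⟩
    simp only [expi]
    rw [integral_exp_mul_complex hc, h2, sub_self, zero_div, smul_zero]

/-- The exponential `e^{inλ}` as an element of `L²`. -/
noncomputable def expLp (n : ℤ) : Lp ℂ 2 circ := (memLp_expi n 2).toLp

theorem inner_expLp (n : ℤ) {v : ℝ → ℂ} (hv : MemLp v 2 circ) :
    inner ℂ (expLp n) hv.toLp = ∫ l, v l * expi (-n) l ∂circ := by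
  rw [L2.inner_def]
  refine integral_congr_ae ?_
  filter_upwards [hv.coeFn_toLp, (memLp_expi (μ := circ) n 2).coeFn_toLp] with l h1 h2
  rw [expLp, h1, h2, RCLike.inner_apply, ← star_expi]; rfl

theorem orthonormal_expLp : Orthonormal ℂ expLp := by
  classical
  rw [orthonormal_iff_ite]
  intro n m
  rw [show expLp m = (memLp_expi m 2).toLp from rfl, inner_expLp]
  simp_rw [← expi_add, integral_expi, ← sub_eq_add_neg, sub_eq_zero, eq_comm]

theorem edist_toLp_sum {α ι : Type*} [MeasurableSpace α] {μ : Measure α} {v : α → ℂ}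
    (hv : MemLp v 2 μ) {x : ι → α → ℂ} (hx : ∀ i, MemLp (x i) 2 μ) (t : Finset ι) (q : ι → ℂ) :
    edist hv.toLp (∑ i ∈ t, q i • (hx i).toLp) =
      eLpNorm (fun ω => v ω - ∑ i ∈ t, q i * x i ω) 2 μ := by
  have h : ∀ i ∈ t, (q i • (hx i).toLp : Lp ℂ 2 μ) =ᵐ[μ] fun ω => q i * x i ω := by
    intro i _
    filter_upwards [Lp.coeFn_smul (q i) (hx i).toLp, (hx i).coeFn_toLp] with ω h1 h2
    rw [h1, Pi.smul_apply, h2, smul_eq_mul]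
  rw [Lp.edist_def]
  refine eLpNorm_congr_ae ?_
  filter_upwards [hv.coeFn_toLp, Lp.coeFn_finsetSum t fun i => q i • (hx i).toLp,
    (t.eventually_all (l := ae μ)).2 h] with ω h1 h2 h3
  rw [Pi.sub_apply, h1, h2, Finset.sum_apply]
  exact congrArg _ (Finset.sum_congr rfl h3)

theorem edist_toLp_sum_expLp {v : ℝ → ℂ} (hv : MemLp v 2 circ) {ι : Type*} (t : Finset ι)
    (q : ι → ℂ) (e : ι → ℤ) :
    edist hv.toLp (∑ i ∈ t, q i • expLp (e i)) =
      eLpNorm (fun l => v l - ∑ i ∈ t, q i * expi (e i) l) 2 circ :=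
  edist_toLp_sum hv (fun i => memLp_expi (e i) 2) t q

theorem span_expLp_dense : ⊤ ≤ (Submodule.span ℂ (Set.range expLp)).topologicalClosure := by
  intro v _
  rw [← SetLike.mem_coe, Submodule.topologicalClosure_coe, EMetric.mem_closure_iff]
  intro ε hε
  obtain ⟨ε', h0, hlt⟩ := exists_between hε
  obtain ⟨p, hp⟩ := exists_trigPoly_approx circ_compl (Lp.memLp v) h0.ne'
  refine ⟨∑ j ∈ p.support, p j • expLp j, Submodule.sum_mem _ fun j _ =>
    Submodule.smul_mem _ _ (Submodule.subset_span ⟨j, rfl⟩), lt_of_le_of_lt ?_ hlt⟩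
  rw [← Lp.toLp_coeFn v (Lp.memLp v), edist_toLp_sum_expLp]
  exact hp

/-- The exponentials `e^{inλ}` as a Hilbert basis of `L²`. -/
noncomputable def expBasis : HilbertBasis ℤ ℂ (Lp ℂ 2 circ) :=
  HilbertBasis.mk orthonormal_expLp span_expLp_dense

theorem expBasis_apply (n : ℤ) : expBasis n = expLp n := by
  rw [expBasis, HilbertBasis.coe_mk]

theorem expBasis_repr {v : ℝ → ℂ} (hv : MemLp v 2 circ) (n : ℤ) :
    expBasis.repr hv.toLp n = ∫ l, v l * expi (-n) l ∂circ := by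
  rw [HilbertBasis.repr_apply_apply, expBasis_apply, inner_expLp]

/-! ### Series over a set of indices -/

variable {T : ℕ} {G : Set ℤ}

theorem isSeries_iff {c : Seq2 T G} {C : ℝ → Fin T → ℂ} :
    IsSeries c C ↔ ∀ ν, ∃ h : MemLp (fun l => C l ν) 2 circ,
      HasSum (fun n : G => c n ν • expLp n) h.toLp := by
  refine forall_congr' fun ν => ?_
  rw [← exists_prop]
  refine exists_congr fun h => ?_
  rw [HasSum, tendsto_iff_edist_tendsto_0]
  simp_rw [edist_comm _ h.toLp, edist_toLp_sum_expLp]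
  rfl

theorem IsSeries.memLp {c : Seq2 T G} {C : ℝ → Fin T → ℂ} (h : IsSeries c C) (ν : Fin T) :
    MemLp (fun l => C l ν) 2 circ := (h ν).1

theorem IsSeries.add {c d : Seq2 T G} {C D : ℝ → Fin T → ℂ} (hc : IsSeries c C)
    (hd : IsSeries d D) : IsSeries (c + d) (C + D) := by
  rw [isSeries_iff] at *
  intro ν
  obtain ⟨h1, h1'⟩ := hc ν
  obtain ⟨h2, h2'⟩ := hd ν
  refine ⟨h1.add h2, ?_⟩
  convert! h1'.add h2' using 2 with n
  simp [add_smul]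

theorem IsSeries.smul {c : Seq2 T G} {C : ℝ → Fin T → ℂ} (hc : IsSeries c C) (z : ℂ) :
    IsSeries (z • c) (z • C) := by
  rw [isSeries_iff] at *
  intro ν
  obtain ⟨h1, h1'⟩ := hc ν
  refine ⟨h1.const_smul z, ?_⟩
  convert! h1'.const_smul z using 2 with n
  simp [mul_smul]

theorem IsSeries.integral_mul_expi {c : Seq2 T G} {C : ℝ → Fin T → ℂ} (hc : IsSeries c C)
    (k : G) (ν : Fin T) : ∫ l, C l ν * expi (-k) l ∂circ = c k ν := by
  classical
  obtain ⟨h, hs⟩ := isSeries_iff.1 hc ν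
  rw [← inner_expLp _ h]
  refine (((innerSL ℂ (expLp k)).hasSum hs).unique (hasSum_single k ?_)).trans ?_
  · intro n hn
    have : (k : ℤ) ≠ n := fun h => hn (Subtype.ext h.symm)
    simp [orthonormal_iff_ite.1 orthonormal_expLp, this]
  · simp [orthonormal_expLp.1]

theorem IsSeries.integral_mul_expi_eq_zero {c : Seq2 T G} {C : ℝ → Fin T → ℂ}
    (hc : IsSeries c C) {k : ℤ} (hk : k ∉ G) (ν : Fin T) :
    ∫ l, C l ν * expi (-k) l ∂circ = 0 := by
  classical
  obtain ⟨h, hs⟩ := isSeries_iff.1 hc ν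
  rw [← inner_expLp _ h]
  refine ((innerSL ℂ (expLp k)).hasSum hs).unique ?_
  convert! hasSum_zero using 2 with n
  have : k ≠ n := fun h => hk (h ▸ n.2)
  simp [orthonormal_iff_ite.1 orthonormal_expLp, this]

/-- The Fourier coefficients of a square-integrable function form a square-summable sequence. -/
theorem exists_fourierSeq (G : Set ℤ) {v : ℝ → Fin T → ℂ}
    (hv : ∀ ν, MemLp (fun l => v l ν) 2 circ) :
    ∃ r : Seq2 T G, ∀ (k : G) ν, r k ν = ∫ l, v l ν * expi (-k) l ∂circ := by
  have hm : Memℓp (fun k : G => (WithLp.toLp 2 fun ν => ∫ l, v l ν * expi (-k) l ∂circ :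
      EuclideanSpace ℂ (Fin T))) 2 := by
    refine memℓp_gen ?_
    simp only [ENNReal.toReal_ofNat, Real.rpow_ofNat, EuclideanSpace.norm_sq_eq]
    refine summable_sum fun ν _ => ?_
    have := (lp.memℓp (expBasis.repr (hv ν).toLp)).summable (by norm_num)
    simp only [expBasis_repr, ENNReal.toReal_ofNat, Real.rpow_ofNat] at this
    exact this.comp_injective Subtype.val_injective
  exact ⟨⟨_, hm⟩, fun k ν => rfl⟩

/-- A square-integrable function whose Fourier coefficients vanish off `G` is the sum of a series
over `G`. -/
theorem exists_isSeries {E : ℝ → Fin T → ℂ} (hE : ∀ ν, MemLp (fun l => E l ν) 2 circ)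
    (h0 : ∀ k ∉ G, ∀ ν, ∫ l, E l ν * expi (-k) l ∂circ = 0) :
    ∃ c : Seq2 T G, IsSeries c E := by
  obtain ⟨c, hc⟩ := exists_fourierSeq G hE
  refine ⟨c, isSeries_iff.2 fun ν => ⟨hE ν, ?_⟩⟩
  have := expBasis.hasSum_repr (hE ν).toLp
  simp only [expBasis_repr, expBasis_apply] at this
  rw [← hasSum_subtype_iff_of_support_subset (s := G)] at this
  · convert! this using 2 with n
    rw [hc]; rfl
  · intro k hk
    by_contra hkG
    exact hk (by simp [h0 k hkG ν])

/-- Parseval's identity for a series over `G` against a square-integrable function. -/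
theorem IsSeries.inner_eq {d r : Seq2 T G} {D v : ℝ → Fin T → ℂ} (hd : IsSeries d D)
    (hv : ∀ ν, MemLp (fun l => v l ν) 2 circ)
    (hr : ∀ (k : G) ν, r k ν = ∫ l, v l ν * expi (-k) l ∂circ) :
    inner ℂ d r = ∫ l, v l ⬝ᵥ star (D l) ∂circ := by
  have h1 : ∀ ν, HasSum (fun n : G => inner ℂ (d n ν) (r n ν))
      (∫ l, v l ν * star (D l ν) ∂circ) := by
    intro ν
    obtain ⟨h, hs⟩ := isSeries_iff.1 hd ν
    have h2 := (innerSL ℂ (hv ν).toLp).hasSum hs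
    have h3 := h2.star
    convert! h3 using 2 with n
    · simp only [innerSL_apply_apply, inner_smul_right,
        ← inner_conj_symm _ (expLp _), inner_expLp, hr]
      simp [mul_comm]
    · simp only [innerSL_apply_apply]
      rw [RCLike.star_def, inner_conj_symm, L2.inner_def]
      refine integral_congr_ae ?_
      filter_upwards [h.coeFn_toLp, (hv ν).coeFn_toLp] with l h1 h2
      rw [h1, h2]; rfl
  have h2 := hasSum_sum (s := Finset.univ) fun ν _ => h1 ν
  have h3 := lp.hasSum_inner (𝕜 := ℂ) d r
  simp only [PiLp.inner_apply] at h3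
  rw [h3.unique h2, ← integral_finsetSum]
  · rfl
  · intro ν _
    exact (hv ν).integrable_mul (hd.memLp ν).star

theorem IsSeries.norm_sq {d : Seq2 T G} {D : ℝ → Fin T → ℂ} (hd : IsSeries d D) :
    (‖d‖ ^ 2 : ℂ) = ∫ l, D l ⬝ᵥ star (D l) ∂circ := by
  rw [← hd.inner_eq hd.memLp fun k ν => (hd.integral_mul_expi k ν).symm,
    inner_self_eq_norm_sq_to_K]
  rfl

/-! ### Square roots of a density and the isometry into the unweighted space -/

/-- `S` is a measurable square root, Hermitian and invertible almost everywhere, of the matrix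
function `F`. -/
structure IsRoot (F S : ℝ → Matrix (Fin T) (Fin T) ℂ) : Prop where
  aestronglyMeasurable : ∀ ν μ, AEStronglyMeasurable (fun l => S l ν μ) circ
  ae : ∀ᵐ l ∂circ, (S l).IsHermitian ∧ S l * S l = F l ∧ IsUnit (S l).det

/-- The map `u ↦ uᵀ S`, which embeds `L₂(S²)` isometrically into the unweighted `L²`. -/
noncomputable def emb (S : ℝ → Matrix (Fin T) (Fin T) ℂ) (u : ℝ → Fin T → ℂ) (l : ℝ) :
    EuclideanSpace ℂ (Fin T) := WithLp.toLp 2 (u l ᵥ* S l)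

theorem aestronglyMeasurable_matrix {F : ℝ → Matrix (Fin T) (Fin T) ℂ}
    (hF : ∀ ν μ, AEStronglyMeasurable (fun l => F l ν μ) circ) : AEStronglyMeasurable F circ := by
  have h : AEMeasurable (fun l => fun ν μ => F l ν μ) circ :=
    aemeasurable_pi_iff.2 fun ν => aemeasurable_pi_iff.2 fun μ => (hF ν μ).aemeasurable
  have h2 : AEStronglyMeasurable (fun l => fun ν μ => F l ν μ) circ := h.aestronglyMeasurable
  exact (continuous_id (X := Fin T → Fin T → ℂ)).comp_aestronglyMeasurable h2

open scoped Matrix.Norms.L2Operator MatrixOrder in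
theorem exists_isRoot {F : ℝ → Matrix (Fin T) (Fin T) ℂ}
    (hF : ∀ ν μ, AEStronglyMeasurable (fun l => F l ν μ) circ)
    (hp : ∀ᵐ l ∂circ, (F l).PosSemidef) (hu : ∀ᵐ l ∂circ, IsUnit (F l).det) :
    ∃ S, IsRoot F S := by
  have hm := aestronglyMeasurable_matrix hF
  refine ⟨fun l => CFC.sqrt (F l), fun ν μ => ?_, ?_⟩
  · classical
    let _ : MeasurableSpace (Matrix (Fin T) (Fin T) ℂ) := borel _
    have : BorelSpace (Matrix (Fin T) (Fin T) ℂ) := ⟨rfl⟩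
    have hmeas : Measurable (Set.piecewise {a : Matrix (Fin T) (Fin T) ℂ | 0 ≤ a} CFC.sqrt
        fun _ => 0) :=
      CFC.continuousOn_sqrt.measurable_piecewise continuousOn_const
        CStarAlgebra.isClosed_nonneg.measurableSet
    have h1 : AEMeasurable (fun l => CFC.sqrt (F l)) circ := by
      refine (hmeas.comp_aemeasurable hm.aemeasurable).congr ?_
      filter_upwards [hp] with l hl
      exact Set.piecewise_eq_of_mem _ _ _ (Matrix.nonneg_iff_posSemidef.2 hl)
    have h2 : Measurable fun a : Matrix (Fin T) (Fin T) ℂ => a ν μ :=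
      (Continuous.matrix_elem continuous_id ν μ).measurable
    exact (h2.comp_aemeasurable h1).aestronglyMeasurable
  · filter_upwards [hp, hu] with l h1 h2
    have h3 : CFC.sqrt (F l) * CFC.sqrt (F l) = F l := CFC.sqrt_mul_sqrt_self _ h1.nonneg
    refine ⟨(Matrix.nonneg_iff_posSemidef.1 (CFC.sqrt_nonneg (F l))).1, h3, ?_⟩
    rw [← h3, Matrix.det_mul] at h2
    exact isUnit_of_mul_isUnit_left h2

theorem aestronglyMeasurable_inv {S : ℝ → Matrix (Fin T) (Fin T) ℂ}
    (hS : ∀ ν μ, AEStronglyMeasurable (fun l => S l ν μ) circ) (ν μ : Fin T) :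
    AEStronglyMeasurable (fun l => (S l)⁻¹ ν μ) circ := by
  have hm := aestronglyMeasurable_matrix hS
  have h1 : AEStronglyMeasurable (fun l => (S l).det) circ :=
    (Continuous.matrix_det continuous_id).comp_aestronglyMeasurable hm
  have h2 : AEStronglyMeasurable (fun l => (S l).adjugate ν μ) circ :=
    ((Continuous.matrix_adjugate continuous_id).matrix_elem ν μ).comp_aestronglyMeasurable hm
  simp only [Matrix.inv_def, Matrix.smul_apply, Ring.inverse_eq_inv, smul_eq_mul]
  exact h1.aemeasurable.inv.aestronglyMeasurable.mul h2

theorem dotProduct_mul_mulVec_star {S : Matrix (Fin T) (Fin T) ℂ} (hS : S.IsHermitian)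
    (u v : Fin T → ℂ) :
    u ⬝ᵥ ((S * S) *ᵥ star v) =
      inner ℂ (WithLp.toLp 2 (v ᵥ* S) : EuclideanSpace ℂ (Fin T)) (WithLp.toLp 2 (u ᵥ* S)) := by
  rw [EuclideanSpace.inner_toLp_toLp, Matrix.star_vecMul, hS.eq, ← Matrix.dotProduct_mulVec,
    Matrix.mulVec_mulVec]

theorem emb_add (S : ℝ → Matrix (Fin T) (Fin T) ℂ) (u v : ℝ → Fin T → ℂ) :
    emb S (u + v) = emb S u + emb S v := by
  funext l; simp [emb, Matrix.add_vecMul]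

theorem emb_sub (S : ℝ → Matrix (Fin T) (Fin T) ℂ) (u v : ℝ → Fin T → ℂ) :
    emb S (u - v) = emb S u - emb S v := by
  funext l; simp [emb, Matrix.sub_vecMul]

theorem emb_smul (S : ℝ → Matrix (Fin T) (Fin T) ℂ) (z : ℂ) (u : ℝ → Fin T → ℂ) :
    emb S (z • u) = z • emb S u := by
  funext l; simp [emb, Matrix.smul_vecMul]

theorem aestronglyMeasurable_vecMul {S : ℝ → Matrix (Fin T) (Fin T) ℂ} {u : ℝ → Fin T → ℂ}
    (hS : ∀ ν μ, AEStronglyMeasurable (fun l => S l ν μ) circ)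
    (hu : ∀ ν, AEStronglyMeasurable (fun l => u l ν) circ) (ν : Fin T) :
    AEStronglyMeasurable (fun l => (u l ᵥ* S l) ν) circ := by
  simp only [Matrix.vecMul, dotProduct]
  exact Finset.aestronglyMeasurable_fun_sum _ fun μ _ => (hu μ).mul (hS μ ν)

theorem aestronglyMeasurable_toLp {u : ℝ → Fin T → ℂ}
    (hu : ∀ ν, AEStronglyMeasurable (fun l => u l ν) circ) :
    AEStronglyMeasurable (fun l => (WithLp.toLp 2 (u l) : EuclideanSpace ℂ (Fin T))) circ := by
  refine (PiLp.continuous_toLp 2 _).comp_aestronglyMeasurable (f := u) ?_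
  exact (aemeasurable_pi_iff.2 fun ν => (hu ν).aemeasurable).aestronglyMeasurable

namespace IsRoot
variable {F S : ℝ → Matrix (Fin T) (Fin T) ℂ} (hS : IsRoot F S)
include hS

theorem inv : IsRoot (fun l => (F l)⁻¹) fun l => (S l)⁻¹ := by
  refine ⟨aestronglyMeasurable_inv hS.1, ?_⟩
  filter_upwards [hS.ae] with l ⟨h1, h2, h3⟩
  refine ⟨h1.inv, ?_, ?_⟩
  · rw [← h2, Matrix.mul_inv_rev]
  · rw [Matrix.det_nonsing_inv]; exact h3.ringInverse

theorem aestronglyMeasurable_emb {u : ℝ → Fin T → ℂ}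
    (hu : ∀ ν, AEStronglyMeasurable (fun l => u l ν) circ) :
    AEStronglyMeasurable (emb S u) circ :=
  aestronglyMeasurable_toLp (aestronglyMeasurable_vecMul hS.1 hu)

theorem form_eq : ∀ᵐ l ∂circ, ∀ u v : ℝ → Fin T → ℂ,
    u l ⬝ᵥ (F l *ᵥ star (v l)) = inner ℂ (emb S v l) (emb S u l) := by
  filter_upwards [hS.ae] with l ⟨h1, h2, _⟩ u v
  rw [← h2, dotProduct_mul_mulVec_star h1]; rfl

theorem re_form_eq : ∀ᵐ l ∂circ, ∀ u : ℝ → Fin T → ℂ,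
    (u l ⬝ᵥ (F l *ᵥ star (u l))).re = ‖emb S u l‖ ^ 2 := by
  filter_upwards [hS.form_eq] with l h u
  rw [h, ← inner_self_eq_norm_sq (𝕜 := ℂ)]; rfl

theorem energy_eq (u : ℝ → Fin T → ℂ) : energy F u = eLpNorm (emb S u) 2 circ ^ 2 := by
  have h : eLpNorm (emb S u) 2 circ ^ 2 = ∫⁻ l, ‖emb S u l‖ₑ ^ 2 ∂circ := by
    have := eLpNorm_nnreal_pow_eq_lintegral (f := emb S u) (μ := circ) (p := 2) (by norm_num)
    simpa using this
  rw [h, energy]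
  refine lintegral_congr_ae ?_
  filter_upwards [hS.re_form_eq] with l h
  rw [h u, ENNReal.ofReal_pow (norm_nonneg _), ofReal_norm]

theorem memLp_emb {u : ℝ → Fin T → ℂ} (hu : ∀ ν, AEStronglyMeasurable (fun l => u l ν) circ)
    (he : energy F u < ∞) : MemLp (emb S u) 2 circ := by
  refine ⟨hS.aestronglyMeasurable_emb hu, ?_⟩
  rw [hS.energy_eq] at he
  by_contra h
  rw [not_lt, top_le_iff] at h
  simp [h] at he

theorem energy_lt_top {u : ℝ → Fin T → ℂ} (h : MemLp (emb S u) 2 circ) : energy F u < ∞ := by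
  rw [hS.energy_eq]; exact ENNReal.pow_lt_top h.2

theorem integral_form {u v : ℝ → Fin T → ℂ} (hu : MemLp (emb S u) 2 circ)
    (hv : MemLp (emb S v) 2 circ) :
    ∫ l, u l ⬝ᵥ (F l *ᵥ star (v l)) ∂circ = inner ℂ hv.toLp hu.toLp := by
  rw [L2.inner_def]
  refine integral_congr_ae ?_
  filter_upwards [hS.form_eq, hu.coeFn_toLp, hv.coeFn_toLp] with l h h1 h2
  rw [h, h1, h2]

theorem integrable_form {u v : ℝ → Fin T → ℂ} (hu : MemLp (emb S u) 2 circ)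
    (hv : MemLp (emb S v) 2 circ) :
    Integrable (fun l => u l ⬝ᵥ (F l *ᵥ star (v l))) circ := by
  refine (L2.integrable_inner (𝕜 := ℂ) hv.toLp hu.toLp).congr ?_
  filter_upwards [hS.form_eq, hu.coeFn_toLp, hv.coeFn_toLp] with l h h1 h2
  rw [h, h1, h2]

theorem emb_vecMul_inv (C : ℝ → Fin T → ℂ) :
    emb S (fun l => C l ᵥ* (F l)⁻¹) =ᵐ[circ] emb (fun l => (S l)⁻¹) C := by
  filter_upwards [hS.ae] with l ⟨_, h2, h3⟩
  simp only [emb]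
  rw [Matrix.vecMul_vecMul, ← h2, Matrix.mul_inv_rev, Matrix.mul_assoc,
    Matrix.nonsing_inv_mul _ h3, Matrix.mul_one]

theorem emb_vecMul (w : ℝ → Fin T → ℂ) :
    emb (fun l => (S l)⁻¹) (fun l => w l ᵥ* F l) =ᵐ[circ] emb S w := by
  filter_upwards [hS.ae] with l ⟨_, h2, h3⟩
  simp only [emb]
  rw [Matrix.vecMul_vecMul, ← h2, Matrix.mul_assoc, Matrix.mul_nonsing_inv _ h3, Matrix.mul_one]

/-- Every element of the unweighted `L²` is in the range of the embedding. -/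
theorem exists_emb_eq (w : Lp (EuclideanSpace ℂ (Fin T)) 2 circ) :
    ∃ u : ℝ → Fin T → ℂ, (∀ ν, AEStronglyMeasurable (fun l => u l ν) circ) ∧
      emb S u =ᵐ[circ] w := by
  refine ⟨fun l => (w l).ofLp ᵥ* (S l)⁻¹, aestronglyMeasurable_vecMul hS.inv.1 fun ν => ?_, ?_⟩
  · exact (PiLp.continuous_apply 2 _ ν).comp_aestronglyMeasurable (Lp.aestronglyMeasurable w)
  · filter_upwards [hS.ae] with l ⟨_, _, h3⟩
    simp only [emb]
    rw [Matrix.vecMul_vecMul, Matrix.nonsing_inv_mul _ h3, Matrix.vecMul_one]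

/-- The embedding is injective up to equality almost everywhere. -/
theorem ae_eq_of_emb_ae_eq {u v : ℝ → Fin T → ℂ} (h : emb S u =ᵐ[circ] emb S v) :
    u =ᵐ[circ] v := by
  filter_upwards [hS.ae, h] with l ⟨_, _, h3⟩ h
  have h' : u l ᵥ* S l = v l ᵥ* S l := congrArg WithLp.ofLp h
  have := congrArg (· ᵥ* (S l)⁻¹) h'
  simpa [Matrix.vecMul_vecMul, Matrix.mul_nonsing_inv _ h3] using this

end IsRoot

/-! ### Invertibility of `B` bounds the symbol from below -/

/-- A weight which dominates a constant in mean square on all trigonometric polynomials dominates it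
almost everywhere. -/
theorem ae_le_of_eLpNorm_trigPoly_le {w : ℝ → ℝ≥0∞} (hw : AEMeasurable w circ)
    (hfin : ∫⁻ l, w l ∂circ ≠ ∞) {α κ : ℝ≥0∞} (hα : α ≠ ∞) (hκ : κ ≠ ∞)
    (h : ∀ p : ℤ →₀ ℂ, α * eLpNorm (fun l => ∑ j ∈ p.support, p j * expi j l) 2 circ ≤
      κ * eLpNorm (fun l => ∑ j ∈ p.support, p j * expi j l) 2 (circ.withDensity w)) :
    ∀ᵐ l ∂circ, α ^ 2 ≤ κ ^ 2 * w l := by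
  have : IsFiniteMeasure (circ.withDensity w) := isFiniteMeasure_withDensity hfin
  -- both norms are continuous in `L²` of the sum of the two measures, where polynomials are dense
  have key : ∀ ψ : ℝ → ℂ, MemLp ψ 2 (circ + circ.withDensity w) →
      α * eLpNorm ψ 2 circ ≤ κ * eLpNorm ψ 2 (circ.withDensity w) := by
    intro ψ hψ
    have h1 : MemLp ψ 2 circ := hψ.mono_measure (Measure.le_add_right le_rfl)
    have h2 : MemLp ψ 2 (circ.withDensity w) := hψ.mono_measure (Measure.le_add_left le_rfl)
    have hfin' : κ * eLpNorm ψ 2 (circ.withDensity w) ≠ ∞ := ENNReal.mul_ne_top hκ h2.2.ne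
    have hstep : ∀ ε : ℝ≥0∞, ε ≠ 0 → α * eLpNorm ψ 2 circ ≤
        κ * eLpNorm ψ 2 (circ.withDensity w) + (κ + α) * ε := by
      intro ε hε
      have hnull : (circ + circ.withDensity w) (Set.Ioc (-Real.pi) Real.pi)ᶜ = 0 := by
        rw [Measure.add_apply, circ_compl, zero_add]
        exact withDensity_absolutelyContinuous _ _ circ_compl
      obtain ⟨p, hp⟩ := exists_trigPoly_approx hnull hψ hε
      have hφ : Continuous fun l => ∑ j ∈ p.support, p j * expi j l :=
        continuous_finsetSum _ fun j _ => continuous_const.mul (continuous_expi j)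
      set φ := fun l => ∑ j ∈ p.support, p j * expi j l with hφdef
      have e1 : eLpNorm ψ 2 circ ≤ eLpNorm φ 2 circ + ε := by
        have : ψ = φ + (ψ - φ) := by abel
        calc eLpNorm ψ 2 circ = eLpNorm (φ + (ψ - φ)) 2 circ := by rw [← this]
          _ ≤ eLpNorm φ 2 circ + eLpNorm (ψ - φ) 2 circ :=
            eLpNorm_add_le hφ.aestronglyMeasurable (h1.1.sub hφ.aestronglyMeasurable) (by norm_num)
          _ ≤ _ := by
            gcongr
            exact (eLpNorm_mono_measure _ (Measure.le_add_right le_rfl)).trans hp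
      have e2 : eLpNorm φ 2 (circ.withDensity w) ≤ eLpNorm ψ 2 (circ.withDensity w) + ε := by
        have : φ = ψ - (ψ - φ) := by abel
        calc eLpNorm φ 2 (circ.withDensity w)
            = eLpNorm (ψ - (ψ - φ)) 2 (circ.withDensity w) := by rw [← this]
          _ ≤ eLpNorm ψ 2 (circ.withDensity w) + eLpNorm (ψ - φ) 2 (circ.withDensity w) :=
            eLpNorm_sub_le h2.1 (h2.1.sub hφ.aestronglyMeasurable) (by norm_num)
          _ ≤ _ := by
            gcongr
            exact (eLpNorm_mono_measure _ (Measure.le_add_left le_rfl)).trans hp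
      calc α * eLpNorm ψ 2 circ ≤ α * (eLpNorm φ 2 circ + ε) := by gcongr
        _ = α * eLpNorm φ 2 circ + α * ε := mul_add _ _ _
        _ ≤ κ * eLpNorm φ 2 (circ.withDensity w) + α * ε :=
          add_le_add (h p) le_rfl
        _ ≤ κ * (eLpNorm ψ 2 (circ.withDensity w) + ε) + α * ε := by gcongr
        _ = _ := by ring
    refine ENNReal.le_of_forall_pos_le_add fun ε hε _ => ?_
    have hne : (κ + α + 1 : ℝ≥0∞) ≠ ∞ := by simp [hκ, hα]
    have hne0 : (κ + α + 1 : ℝ≥0∞) ≠ 0 := by simp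
    refine (hstep (ε / (κ + α + 1)) (ENNReal.div_pos (by exact_mod_cast hε.ne') hne).ne').trans ?_
    gcongr
    calc (κ + α) * (ε / (κ + α + 1)) ≤ (κ + α + 1) * (ε / (κ + α + 1)) :=
          mul_le_mul' le_self_add le_rfl
      _ = ε := ENNReal.mul_div_cancel hne0 hne
  refine ae_le_of_forall_setLIntegral_le_of_sigmaFinite₀ aemeasurable_const fun A hA _ => ?_
  have h1 := key (A.indicator fun _ => 1) ((memLp_const (1 : ℂ)).indicator hA)
  have h2 : ∀ μ : Measure ℝ, eLpNorm (A.indicator fun _ => (1 : ℂ)) 2 μ ^ 2 = μ A := by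
    intro μ
    have := eLpNorm_indicator_const (μ := μ) (p := 2) (c := (1 : ℂ)) hA (by norm_num) (by norm_num)
    have h3 : eLpNorm (A.indicator fun _ => (1 : ℂ)) 2 μ = (μ A) ^ (1 / 2 : ℝ) := by
      simpa using this
    rw [h3, ← ENNReal.rpow_natCast, ← ENNReal.rpow_mul]
    norm_num
  have h3 := pow_le_pow_left' h1 2
  rw [mul_pow, mul_pow, h2, h2, withDensity_apply _ hA] at h3
  rw [setLIntegral_const, lintegral_const_mul'' _ hw.restrict]
  exact h3

theorem Bform_eq_inner {f g S : ℝ → Matrix (Fin T) (Fin T) ℂ} (hS : IsRoot (fun l => f l + g l) S)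
    {C D : ℝ → Fin T → ℂ} (hC : MemLp (emb (fun l => (S l)⁻¹) C) 2 circ)
    (hD : MemLp (emb (fun l => (S l)⁻¹) D) 2 circ) :
    Bform f g C D = inner ℂ hD.toLp hC.toLp := hS.inv.integral_form hC hD

theorem IsSeries.memLp_emb {G : Set ℤ} {F S : ℝ → Matrix (Fin T) (Fin T) ℂ} (hS : IsRoot F S)
    {c : Seq2 T G} {C : ℝ → Fin T → ℂ} (hC : IsSeries c C)
    (he : energy F C < ∞) : MemLp (emb S C) 2 circ :=
  hS.memLp_emb (fun ν => (hC.memLp ν).1) he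

/-- The form of `B` is bounded below: `B⁻¹` is symmetric and everywhere defined, hence bounded. -/
theorem exists_norm_sq_le_energy {f g S : ℝ → Matrix (Fin T) (Fin T) ℂ} {G : Set ℤ}
    (hS : IsRoot (fun l => f l + g l) S) (hB : BInvertible f g G) :
    ∃ K : ℝ, 0 ≤ K ∧ ∀ (d : Seq2 T G) (D : ℝ → Fin T → ℂ), IsSeries d D →
      ∀ hD : MemLp (emb (fun l => (S l)⁻¹) D) 2 circ, ‖d‖ ^ 2 ≤ K * ‖hD.toLp‖ ^ 2 := by
  choose Gf hG huniq using hB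
  have hadd : ∀ x y, Gf (x + y) = Gf x + Gf y := by
    intro x y
    refine (huniq _ _ ?_).symm
    obtain ⟨C, hC, he, hq⟩ := hG x
    obtain ⟨C', hC', he', hq'⟩ := hG y
    have m1 := hC.memLp_emb hS.inv he
    have m2 := hC'.memLp_emb hS.inv he'
    have m3 : MemLp (emb (fun l => (S l)⁻¹) (C + C')) 2 circ := by
      rw [emb_add]; exact m1.add m2
    refine ⟨C + C', hC.add hC', hS.inv.energy_lt_top m3, fun d D hD hDe => ?_⟩
    have m4 := hD.memLp_emb hS.inv hDe
    have h1 := hq d D hD hDe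
    have h2 := hq' d D hD hDe
    rw [Bform_eq_inner hS ‹_› ‹_›] at h1 h2 ⊢
    rw [inner_add_right, ← h1, ← h2, ← inner_add_right, ← MemLp.toLp_add]
    congr 2
    simp [emb_add]
  have hsmul : ∀ (z : ℂ) x, Gf (z • x) = z • Gf x := by
    intro z x
    refine (huniq _ _ ?_).symm
    obtain ⟨C, hC, he, hq⟩ := hG x
    have m1 := hC.memLp_emb hS.inv he
    have m3 : MemLp (emb (fun l => (S l)⁻¹) (z • C)) 2 circ := by
      rw [emb_smul]; exact m1.const_smul z
    refine ⟨z • C, hC.smul z, hS.inv.energy_lt_top m3, fun d D hD hDe => ?_⟩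
    have m4 := hD.memLp_emb hS.inv hDe
    have h1 := hq d D hD hDe
    rw [Bform_eq_inner hS ‹_› ‹_›] at h1 ⊢
    rw [inner_smul_right, ← h1, ← inner_smul_right, ← MemLp.toLp_const_smul]
    congr 2
    simp [emb_smul]
  let L : Seq2 T G →ₗ[ℂ] Seq2 T G :=
    { toFun := Gf, map_add' := hadd, map_smul' := hsmul }
  have hsymm : L.IsSymmetric := by
    intro x y
    obtain ⟨C, hC, he, hq⟩ := hG x
    obtain ⟨C', hC', he', hq'⟩ := hG y
    have m1 := hC.memLp_emb hS.inv he
    have m2 := hC'.memLp_emb hS.inv he'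
    have h1 := hq _ _ hC' he'
    have h2 := hq' _ _ hC he
    rw [Bform_eq_inner hS ‹_› ‹_›] at h1 h2
    change inner ℂ (Gf x) y = inner ℂ x (Gf y)
    rw [← inner_conj_symm x, ← h1, ← h2, inner_conj_symm]
  let L' : Seq2 T G →L[ℂ] Seq2 T G := ⟨L, hsymm.continuous⟩
  refine ⟨‖L'‖, norm_nonneg _, fun d D hD mD => ?_⟩
  obtain ⟨C, hC, he, hq⟩ := hG d
  have mC := hC.memLp_emb hS.inv he
  have h1 := hq d D hD (hS.inv.energy_lt_top mD)
  have h2 := hq _ C hC he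
  rw [Bform_eq_inner hS ‹_› ‹_›] at h1 h2
  have e1 : ‖d‖ ^ 2 ≤ ‖mD.toLp‖ * ‖mC.toLp‖ := by
    rw [← inner_self_eq_norm_sq (𝕜 := ℂ), ← h1]
    exact (RCLike.re_le_norm _).trans (norm_inner_le_norm _ _)
  have e2 : ‖mC.toLp‖ ^ 2 ≤ ‖L'‖ * ‖d‖ ^ 2 := by
    rw [← inner_self_eq_norm_sq (𝕜 := ℂ), h2]
    refine (RCLike.re_le_norm _).trans ((norm_inner_le_norm _ _).trans ?_)
    have : ‖Gf d‖ ≤ ‖L'‖ * ‖d‖ := L'.le_opNorm d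
    nlinarith [norm_nonneg d]
  rcases eq_or_ne d 0 with rfl | hd
  · simp; positivity
  · have hpos : 0 < ‖d‖ ^ 2 := by positivity
    have e3 : (‖d‖ ^ 2) * ‖d‖ ^ 2 ≤ (‖L'‖ * ‖mD.toLp‖ ^ 2) * ‖d‖ ^ 2 := by
      calc (‖d‖ ^ 2) * ‖d‖ ^ 2 ≤ (‖mD.toLp‖ * ‖mC.toLp‖) * (‖mD.toLp‖ * ‖mC.toLp‖) := by gcongr
        _ = ‖mD.toLp‖ ^ 2 * ‖mC.toLp‖ ^ 2 := by ring
        _ ≤ ‖mD.toLp‖ ^ 2 * (‖L'‖ * ‖d‖ ^ 2) := by gcongr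
        _ = _ := by ring
    exact le_of_mul_le_mul_right e3 hpos

theorem eLpNorm_eq_ofReal_norm_toLp {E : Type*} [NormedAddCommGroup E] {μ : Measure ℝ} {u : ℝ → E}
    (hu : MemLp u 2 μ) : eLpNorm u 2 μ = ENNReal.ofReal ‖hu.toLp‖ := by
  rw [Lp.norm_toLp, ENNReal.ofReal_toReal hu.2.ne]

theorem eLpNorm_two_sq {E : Type*} [NormedAddCommGroup E] (μ : Measure ℝ) (u : ℝ → E) :
    eLpNorm u 2 μ ^ 2 = ∫⁻ l, ‖u l‖ₑ ^ 2 ∂μ := by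
  simpa using eLpNorm_nnreal_pow_eq_lintegral (f := u) (μ := μ) (p := 2) (by norm_num)

theorem memLp_emb_inv_const {F S : ℝ → Matrix (Fin T) (Fin T) ℂ}
    (hS : IsRoot F S)
    (hint : ∀ ν μ, Integrable (fun l => (F l)⁻¹ ν μ) circ) (v : Fin T → ℂ) :
    MemLp (emb (fun l => (S l)⁻¹) fun _ => v) 2 circ := by
  refine hS.inv.memLp_emb (fun ν => aestronglyMeasurable_const) ?_
  have h : Integrable (fun l => v ⬝ᵥ ((F l)⁻¹ *ᵥ star v)) circ := by
    simp only [dotProduct, Matrix.mulVec]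
    exact integrable_finsetSum _ fun ν _ =>
      (integrable_finsetSum _ fun μ _ => (hint ν μ).mul_const _).const_mul _
  refine lt_of_le_of_lt (lintegral_mono fun l => ?_) h.2
  rw [← ofReal_norm]
  exact ENNReal.ofReal_le_ofReal (Complex.re_le_norm _)

/-- If `B` is invertible, then `F = f + g` is essentially bounded: the lower bound for the form of
`B` on shifted trigonometric polynomials is a pointwise lower bound for `F⁻¹`. -/
theorem exists_norm_vecMul_root_le {f g S : ℝ → Matrix (Fin T) (Fin T) ℂ} {G : Set ℤ}
    (hS : IsRoot (fun l => f l + g l) S)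
    (hint : ∀ ν μ, Integrable (fun l => (f l + g l)⁻¹ ν μ) circ)
    (hG : Set.Ici 0 ⊆ G) (hB : BInvertible f g G) :
    ∃ M : ℝ, 0 ≤ M ∧ ∀ᵐ l ∂circ, ∀ x : Fin T → ℂ,
      ‖(WithLp.toLp 2 (x ᵥ* S l) : EuclideanSpace ℂ (Fin T))‖ ≤
        M * ‖(WithLp.toLp 2 x : EuclideanSpace ℂ (Fin T))‖ := by
  obtain ⟨K, hK, hlow⟩ := exists_norm_sq_le_energy hS hB
  refine ⟨√K, Real.sqrt_nonneg _, ?_⟩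
  have hv : ∀ v : EuclideanSpace ℂ (Fin T), ∀ᵐ l ∂circ,
      ‖v‖ ≤ √K * ‖(WithLp.toLp 2 (v.ofLp ᵥ* (S l)⁻¹) : EuclideanSpace ℂ (Fin T))‖ := by
    intro v
    have mv := memLp_emb_inv_const hS hint v.ofLp
    have hw : AEMeasurable (fun l => ‖emb (fun l => (S l)⁻¹) (fun _ => v.ofLp) l‖ₑ ^ 2) circ :=
      mv.1.enorm.pow_const 2
    have hfin : ∫⁻ l, ‖emb (fun l => (S l)⁻¹) (fun _ => v.ofLp) l‖ₑ ^ 2 ∂circ ≠ ∞ := by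
      rw [← eLpNorm_two_sq]
      exact (ENNReal.pow_lt_top mv.2).ne
    have := ae_le_of_eLpNorm_trigPoly_le hw hfin (α := ENNReal.ofReal ‖v‖)
      (κ := ENNReal.ofReal √K) ENNReal.ofReal_ne_top ENNReal.ofReal_ne_top ?_
    · filter_upwards [this] with l hl
      rw [← ofReal_norm, ← mul_pow, ← ENNReal.ofReal_mul (Real.sqrt_nonneg _)] at hl
      have h2 := (ENNReal.pow_le_pow_left_iff two_ne_zero).1 hl
      exact (ENNReal.ofReal_le_ofReal_iff (by positivity)).1 h2
    intro p
    set φ : ℝ → ℂ := fun l => ∑ j ∈ p.support, p j * expi j l with hφ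
    have hφc : Continuous φ :=
      continuous_finsetSum _ fun j _ => continuous_const.mul (continuous_expi j)
    have hφb : ∀ l, ‖φ l‖ ≤ ∑ j ∈ p.support, ‖p j‖ := fun l =>
      (norm_sum_le _ _).trans (Finset.sum_le_sum fun j _ => by rw [norm_mul, norm_expi, mul_one])
    have mφ : MemLp φ 2 circ :=
      MemLp.of_bound hφc.aestronglyMeasurable _ (Eventually.of_forall hφb)
    -- multiplication by `e^{imλ}` moves the polynomial into the span over `G`
    obtain ⟨m, hm⟩ : ∃ m : ℤ, ∀ j ∈ p.support, 0 ≤ j + m := by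
      refine ⟨∑ j ∈ p.support, |j|, fun j hj => ?_⟩
      have h1 := Finset.single_le_sum (f := fun j : ℤ => |j|) (fun i _ => abs_nonneg i) hj
      have h2 := neg_abs_le j
      linarith
    let D : ℝ → Fin T → ℂ := fun l => (expi m l * φ l) • v.ofLp
    have hD : ∀ ν, MemLp (fun l => D l ν) 2 circ := fun ν => by
      refine MemLp.of_bound (C := (∑ j ∈ p.support, ‖p j‖) * ‖v ν‖) ?_
        (Eventually.of_forall fun l => ?_)
      · exact (((continuous_expi m).mul hφc).mul continuous_const).aestronglyMeasurable
      · simp only [D, Pi.smul_apply, smul_eq_mul, norm_mul, norm_expi, one_mul]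
        gcongr
        exact hφb l
    obtain ⟨d, hd⟩ := exists_isSeries (G := G) hD (by
      intro k hk ν
      have h1 : ∀ l, D l ν * expi (-k) l =
          ∑ j ∈ p.support, (p j * v ν) * expi (j + m - k) l := by
        intro l
        simp only [D, hφ, Pi.smul_apply, smul_eq_mul, Finset.mul_sum, Finset.sum_mul,
          sub_eq_add_neg, expi_add]
        exact Finset.sum_congr rfl fun j _ => by ring
      simp_rw [h1]
      rw [integral_finsetSum _ fun j _ => ((memLp_expi _ 1).integrable le_rfl).const_mul _]
      refine Finset.sum_eq_zero fun j hj => ?_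
      rw [integral_const_mul, integral_expi, if_neg, mul_zero]
      intro h0
      exact hk (hG (by have := hm j hj; simp only [Set.mem_Ici]; omega)))
    have hnorm : ∀ l, ‖emb (fun l => (S l)⁻¹) D l‖ =
        ‖φ l‖ * ‖emb (fun l => (S l)⁻¹) (fun _ => v.ofLp) l‖ := by
      intro l
      simp only [emb, D, Matrix.smul_vecMul, WithLp.toLp_smul, norm_smul, norm_mul, norm_expi,
        one_mul]
    have mD : MemLp (emb (fun l => (S l)⁻¹) D) 2 circ := by
      refine mv.of_le_mul (c := ∑ j ∈ p.support, ‖p j‖)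
        (hS.inv.aestronglyMeasurable_emb fun ν => (hD ν).1) (Eventually.of_forall fun l => ?_)
      rw [hnorm]
      gcongr
      exact hφb l
    have h1 := hlow d D hd mD
    have h2 : ‖d‖ ^ 2 = (‖v‖ * ‖mφ.toLp‖) ^ 2 := by
      have h3 : ((‖d‖ ^ 2 : ℝ) : ℂ) = ((‖v‖ * ‖mφ.toLp‖) ^ 2 : ℝ) := by
        have e1 : (‖mφ.toLp‖ ^ 2 : ℂ) = ∫ l, φ l * star (φ l) ∂circ := by
          have := inner_self_eq_norm_sq_to_K (𝕜 := ℂ) mφ.toLp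
          rw [L2.inner_def] at this
          refine Eq.trans this.symm (integral_congr_ae ?_)
          filter_upwards [mφ.coeFn_toLp] with l hl
          rw [hl]; rfl
        have e2 : (‖v‖ ^ 2 : ℂ) = v.ofLp ⬝ᵥ star v.ofLp := by
          have := inner_self_eq_norm_sq_to_K (𝕜 := ℂ) v
          rw [EuclideanSpace.inner_eq_star_dotProduct] at this
          exact this.symm
        push_cast
        rw [hd.norm_sq, mul_pow, e1, e2, ← integral_const_mul]
        congr 1
        funext l
        have e3 : expi m l * star (expi m l) = 1 := by
          rw [expi_mul_star, sub_self]; simp [expi]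
        simp only [D, star_smul, smul_dotProduct, dotProduct_smul, smul_eq_mul, star_mul']
        linear_combination (φ l * star (φ l) * v.ofLp ⬝ᵥ star v.ofLp) * e3
      exact_mod_cast h3
    have h4 : eLpNorm φ 2 (circ.withDensity fun l =>
        ‖emb (fun l => (S l)⁻¹) (fun _ => v.ofLp) l‖ₑ ^ 2) =
          eLpNorm (emb (fun l => (S l)⁻¹) D) 2 circ := by
      refine (ENNReal.pow_right_strictMono two_ne_zero).injective ?_
      simp only
      rw [eLpNorm_two_sq, eLpNorm_two_sq, lintegral_withDensity_eq_lintegral_mul₀ hw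
        (hφc.enorm.measurable.pow_const 2).aemeasurable]
      refine lintegral_congr fun l => ?_
      rw [Pi.mul_apply, ← mul_pow, ← ofReal_norm, ← ofReal_norm, ← ofReal_norm, hnorm,
        ENNReal.ofReal_mul (norm_nonneg _), mul_comm]
    rw [h4, eLpNorm_eq_ofReal_norm_toLp mφ, eLpNorm_eq_ofReal_norm_toLp mD,
      ← ENNReal.ofReal_mul (norm_nonneg _), ← ENNReal.ofReal_mul (Real.sqrt_nonneg _)]
    refine ENNReal.ofReal_le_ofReal (le_of_sq_le_sq ?_ (by positivity))
    rw [← h2, mul_pow, Real.sq_sqrt hK]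
    exact h1
  have hall : ∀ᵐ l ∂circ, ∀ n : ℕ, ‖TopologicalSpace.denseSeq (EuclideanSpace ℂ (Fin T)) n‖ ≤
      √K * ‖(WithLp.toLp 2 ((TopologicalSpace.denseSeq (EuclideanSpace ℂ (Fin T)) n).ofLp ᵥ*
        (S l)⁻¹) : EuclideanSpace ℂ (Fin T))‖ := ae_all_iff.2 fun n => hv _
  filter_upwards [hall, hS.ae] with l hl ⟨_, _, hu⟩ x
  have hcl : IsClosed {v : EuclideanSpace ℂ (Fin T) | ‖v‖ ≤
      √K * ‖(WithLp.toLp 2 (v.ofLp ᵥ* (S l)⁻¹) : EuclideanSpace ℂ (Fin T))‖} := by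
    refine isClosed_le continuous_norm (continuous_const.mul (continuous_norm.comp ?_))
    refine (PiLp.continuous_toLp 2 _).comp ?_
    exact (PiLp.continuous_ofLp 2 _).matrix_vecMul continuous_const
  have := hcl.closure_subset_iff.2 (Set.range_subset_iff.2 hl)
    ((TopologicalSpace.denseRange_denseSeq (EuclideanSpace ℂ (Fin T)))
      (WithLp.toLp 2 (x ᵥ* S l)))
  simpa [Matrix.vecMul_vecMul, Matrix.mul_nonsing_inv _ hu] using this

/-! ### The unconstrained optimum -/

/-- The minimiser `uᵀ = aᵀ f (f + g)⁻¹` of the mean-square error over all of `L₂(f + g)`. -/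
noncomputable def wiener (f g : ℝ → Matrix (Fin T) (Fin T) ℂ) (a : ℝ → Fin T → ℂ) (l : ℝ) :
    Fin T → ℂ := (a l ᵥ* f l) ᵥ* (f l + g l)⁻¹

theorem hN_eq (f g : ℝ → Matrix (Fin T) (Fin T) ℂ) (N : ℕ) (a : ℕ → ℂ) (C : ℝ → Fin T → ℂ) :
    hN f g N a C = wiener f g (AN T N a) - fun l => C l ᵥ* (f l + g l)⁻¹ := by
  funext l; simp only [hN, wiener, Matrix.sub_vecMul, Pi.sub_apply]

/-- The quadratic form of `f (f + g)⁻¹ g = f - f (f + g)⁻¹ f`. -/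
theorem dotProduct_parallelSum {f g : Matrix (Fin T) (Fin T) ℂ} (hf : f.IsHermitian)
    (hg : g.IsHermitian) (hu : IsUnit (f + g).det) (a b : Fin T → ℂ) :
    a ⬝ᵥ ((f * (f + g)⁻¹ * g) *ᵥ star b) = a ⬝ᵥ (f *ᵥ star b) -
      (a ᵥ* f ᵥ* (f + g)⁻¹) ⬝ᵥ ((f + g) *ᵥ star (b ᵥ* f ᵥ* (f + g)⁻¹)) := by
  have hF : (f + g).IsHermitian := hf.add hg
  have h1 : (f + g) *ᵥ star (b ᵥ* f ᵥ* (f + g)⁻¹) = f *ᵥ star b := by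
    rw [Matrix.star_vecMul, Matrix.star_vecMul, hF.inv.eq, hf.eq, Matrix.mulVec_mulVec,
      Matrix.mul_nonsing_inv _ hu, Matrix.one_mulVec]
  have h2 : f * (f + g)⁻¹ * g = f - f * (f + g)⁻¹ * f := by
    have : f * (f + g)⁻¹ * (f + g) = f := by
      rw [Matrix.mul_assoc, Matrix.nonsing_inv_mul _ hu, Matrix.mul_one]
    rw [eq_sub_iff_add_eq, ← Matrix.mul_add, add_comm g f, this]
  rw [h1, h2, Matrix.sub_mulVec, dotProduct_sub, Matrix.vecMul_vecMul, ← Matrix.dotProduct_mulVec,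
    Matrix.mulVec_mulVec]

/-- Completing the square in the mean-square error. -/
theorem dotProduct_complete_square {f g : Matrix (Fin T) (Fin T) ℂ} (hf : f.IsHermitian)
    (hg : g.IsHermitian) (hu : IsUnit (f + g).det) (a h : Fin T → ℂ) :
    (a - h) ⬝ᵥ (f *ᵥ star (a - h)) + h ⬝ᵥ (g *ᵥ star h) =
      (h - a ᵥ* f ᵥ* (f + g)⁻¹) ⬝ᵥ ((f + g) *ᵥ star (h - a ᵥ* f ᵥ* (f + g)⁻¹)) +
        a ⬝ᵥ ((f * (f + g)⁻¹ * g) *ᵥ star a) := by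
  have hF : (f + g).IsHermitian := hf.add hg
  have h1 : (f + g) *ᵥ star (a ᵥ* f ᵥ* (f + g)⁻¹) = f *ᵥ star a := by
    rw [Matrix.star_vecMul, Matrix.star_vecMul, hF.inv.eq, hf.eq, Matrix.mulVec_mulVec,
      Matrix.mul_nonsing_inv _ hu, Matrix.one_mulVec]
  have h2 : (a ᵥ* f ᵥ* (f + g)⁻¹) ⬝ᵥ ((f + g) *ᵥ star h) = a ⬝ᵥ (f *ᵥ star h) := by
    rw [Matrix.dotProduct_mulVec, Matrix.vecMul_vecMul, Matrix.nonsing_inv_mul _ hu,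
      Matrix.vecMul_one, Matrix.dotProduct_mulVec]
  rw [dotProduct_parallelSum hf hg hu]
  simp only [star_sub, Matrix.mulVec_sub, dotProduct_sub, sub_dotProduct, h1, h2]
  rw [Matrix.add_mulVec f g (star h), dotProduct_add]
  ring

theorem _root_.Matrix.PosSemidef.dotProduct_mulVec_star_nonneg {M : Matrix (Fin T) (Fin T) ℂ}
    (hM : M.PosSemidef) (a : Fin T → ℂ) : 0 ≤ a ⬝ᵥ (M *ᵥ star a) := by
  simpa using hM.dotProduct_mulVec_nonneg (star a)

/-- The standing assumptions on the spectral densities `f`, `g`, with a root `S` of `f + g`. The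
bound `‖xᵀ S‖ ≤ M ‖x‖` says that `f + g` is bounded; it is a consequence of the invertibility of
`B`. -/
structure IsDensityPair (f g S : ℝ → Matrix (Fin T) (Fin T) ℂ) (M : ℝ) : Prop where
  root : IsRoot (fun l => f l + g l) S
  posSemidef_left : ∀ᵐ l ∂circ, (f l).PosSemidef
  posSemidef_right : ∀ᵐ l ∂circ, (g l).PosSemidef
  isUnit_det : ∀ᵐ l ∂circ, IsUnit (f l + g l).det
  integrable_left : ∀ ν μ, Integrable (fun l => f l ν μ) circ
  integrable_right : ∀ ν μ, Integrable (fun l => g l ν μ) circ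
  integrable_inv : ∀ ν μ, Integrable (fun l => (f l + g l)⁻¹ ν μ) circ
  nonneg : 0 ≤ M
  norm_vecMul_le : ∀ᵐ l ∂circ, ∀ x : Fin T → ℂ,
      ‖(WithLp.toLp 2 (x ᵥ* S l) : EuclideanSpace ℂ (Fin T))‖ ≤
        M * ‖(WithLp.toLp 2 x : EuclideanSpace ℂ (Fin T))‖

open scoped Matrix.Norms.L2Operator MatrixOrder in
theorem _root_.Matrix.PosSemidef.exists_eq_conjTranspose_mul_self
    {A : Matrix (Fin T) (Fin T) ℂ} (hA : A.PosSemidef) : ∃ B, A = Bᴴ * B := by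
  obtain ⟨B, hB⟩ := CStarAlgebra.nonneg_iff_eq_star_mul_self.1 (Matrix.nonneg_iff_posSemidef.2 hA)
  exact ⟨B, hB⟩

/-- Entries of a positive semidefinite integrable family are controlled by the trace. -/
theorem integrable_of_trace {A : ℝ → Matrix (Fin T) (Fin T) ℂ}
    (hm : ∀ ν μ, AEStronglyMeasurable (fun l => A l ν μ) circ)
    (hp : ∀ᵐ l ∂circ, (A l).PosSemidef) (ht : Integrable (fun l => (A l).trace) circ)
    (ν μ : Fin T) : Integrable (fun l => A l ν μ) circ := by
  refine ht.mono (hm ν μ) ?_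
  filter_upwards [hp] with l hl
  obtain ⟨B, hB⟩ := hl.exists_eq_conjTranspose_mul_self
  have htr : (A l).trace = ((∑ i, ∑ k, ‖B k i‖ ^ 2 : ℝ) : ℂ) := by
    rw [hB, Matrix.trace]
    push_cast
    refine Finset.sum_congr rfl fun i _ => ?_
    rw [Matrix.diag_apply, Matrix.mul_apply]
    refine Finset.sum_congr rfl fun k _ => ?_
    rw [Matrix.conjTranspose_apply, RCLike.star_def, RCLike.conj_mul]
    rfl
  have hcol : ∀ i, ∑ k, ‖B k i‖ ^ 2 ≤ ∑ i, ∑ k, ‖B k i‖ ^ 2 := fun i =>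
    Finset.single_le_sum (f := fun i => ∑ k, ‖B k i‖ ^ 2)
      (fun i _ => Finset.sum_nonneg fun k _ => sq_nonneg _) (Finset.mem_univ i)
  rw [htr, Complex.norm_real, Real.norm_of_nonneg
    (Finset.sum_nonneg fun i _ => Finset.sum_nonneg fun k _ => sq_nonneg _)]
  calc ‖A l ν μ‖ = ‖∑ k, star (B k ν) * B k μ‖ := by
        rw [hB, Matrix.mul_apply]; simp only [Matrix.conjTranspose_apply]
    _ ≤ ∑ k, ‖star (B k ν) * B k μ‖ := norm_sum_le _ _
    _ ≤ ∑ k, (‖B k ν‖ ^ 2 + ‖B k μ‖ ^ 2) / 2 := by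
        refine Finset.sum_le_sum fun k _ => ?_
        rw [norm_mul, norm_star]
        nlinarith [sq_nonneg (‖B k ν‖ - ‖B k μ‖)]
    _ = (∑ k, ‖B k ν‖ ^ 2 + ∑ k, ‖B k μ‖ ^ 2) / 2 := by
        rw [← Finset.sum_div, Finset.sum_add_distrib]
    _ ≤ _ := by linarith [hcol ν, hcol μ]

namespace IsDensityPair
variable {f g S : ℝ → Matrix (Fin T) (Fin T) ℂ} {M : ℝ} (H : IsDensityPair f g S M)
include H

theorem memLp_emb_of_bounded {a : ℝ → Fin T → ℂ}
    (ha : ∀ ν, AEStronglyMeasurable (fun l => a l ν) circ) {c : ℝ}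
    (hc : ∀ l, ‖(WithLp.toLp 2 (a l) : EuclideanSpace ℂ (Fin T))‖ ≤ c) :
    MemLp (emb S a) 2 circ := by
  refine MemLp.of_bound (C := M * c) (H.root.aestronglyMeasurable_emb ha) ?_
  filter_upwards [H.norm_vecMul_le] with l hl
  exact (hl (a l)).trans (mul_le_mul_of_nonneg_left (hc l) H.nonneg)

theorem aestronglyMeasurable_wiener {a : ℝ → Fin T → ℂ}
    (ha : ∀ ν, AEStronglyMeasurable (fun l => a l ν) circ) (ν : Fin T) :
    AEStronglyMeasurable (fun l => wiener f g a l ν) circ :=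
  aestronglyMeasurable_vecMul (fun ν μ => (H.integrable_inv ν μ).1)
    (aestronglyMeasurable_vecMul (fun ν μ => (H.integrable_left ν μ).1) ha) ν

/-- `u F u* ≤ a F a*` for `u = a f F⁻¹`: completing the square at `h = u` gives
`u F u* ≤ a f a*`. -/
theorem norm_emb_wiener_le (a : ℝ → Fin T → ℂ) :
    ∀ᵐ l ∂circ, ‖emb S (wiener f g a) l‖ ≤ ‖emb S a l‖ := by
  filter_upwards [H.root.re_form_eq, H.posSemidef_left, H.posSemidef_right, H.isUnit_det]
    with l hr hf hg hu
  have h1 := dotProduct_complete_square hf.1 hg.1 hu (a l) (a l ᵥ* f l ᵥ* (f l + g l)⁻¹)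
  rw [dotProduct_parallelSum hf.1 hg.1 hu, sub_self] at h1
  have h2 := hf.dotProduct_mulVec_star_nonneg (a l - a l ᵥ* f l ᵥ* (f l + g l)⁻¹)
  have h3 := hg.dotProduct_mulVec_star_nonneg (a l ᵥ* f l ᵥ* (f l + g l)⁻¹)
  have h4 := hg.dotProduct_mulVec_star_nonneg (a l)
  have h5 := hr a
  have h6 := hr (wiener f g a)
  rw [Matrix.add_mulVec, dotProduct_add, Complex.add_re] at h5
  have h1' := congrArg Complex.re h1
  simp only [zero_dotProduct, zero_add, Complex.add_re, Complex.sub_re] at h1'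
  rw [show wiener f g a l = a l ᵥ* f l ᵥ* (f l + g l)⁻¹ from rfl] at h6
  rw [h6] at h1'
  have h2' := (Complex.le_def.1 h2).1
  have h3' := (Complex.le_def.1 h3).1
  have h4' := (Complex.le_def.1 h4).1
  simp only [Complex.zero_re] at h2' h3' h4'
  refine le_of_sq_le_sq ?_ (norm_nonneg _)
  linarith

theorem memLp_emb_wiener {a : ℝ → Fin T → ℂ}
    (ha : ∀ ν, AEStronglyMeasurable (fun l => a l ν) circ) {c : ℝ}
    (hc : ∀ l, ‖(WithLp.toLp 2 (a l) : EuclideanSpace ℂ (Fin T))‖ ≤ c) :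
    MemLp (emb S (wiener f g a)) 2 circ :=
  (H.memLp_emb_of_bounded ha hc).of_le
    (H.root.aestronglyMeasurable_emb (H.aestronglyMeasurable_wiener ha)) (H.norm_emb_wiener_le a)

/-- `aᵀ f (f + g)⁻¹` is square integrable: `aᵀ f (f + g)⁻¹ S` is bounded, and the entries of `S⁻¹`
are square integrable. -/
theorem memLp_wiener {a : ℝ → Fin T → ℂ}
    (ha : ∀ ν, AEStronglyMeasurable (fun l => a l ν) circ) {c : ℝ}
    (hc : ∀ l, ‖(WithLp.toLp 2 (a l) : EuclideanSpace ℂ (Fin T))‖ ≤ c) (ν : Fin T) :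
    MemLp (fun l => wiener f g a l ν) 2 circ := by
  have hμ : ∀ μ, MemLp (fun l => (emb S (wiener f g a) l) μ * (S l)⁻¹ μ ν) 2 circ := by
    intro μ
    have h1 := memLp_emb_inv_const H.root H.integrable_inv (Pi.single μ 1)
    refine h1.of_le_mul (c := M * c) ?_ ?_
    · exact ((PiLp.continuous_apply 2 _ μ).comp_aestronglyMeasurable
        (H.memLp_emb_wiener ha hc).1).mul (H.root.inv.1 μ ν)
    · filter_upwards [H.norm_emb_wiener_le a, H.norm_vecMul_le] with l h2 h3
      rw [norm_mul]
      have h4 : ‖(emb S (wiener f g a) l) μ‖ ≤ M * c :=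
        (PiLp.norm_apply_le _ μ).trans (h2.trans ((h3 (a l)).trans
          (mul_le_mul_of_nonneg_left (hc l) H.nonneg)))
      have h5 : ‖(S l)⁻¹ μ ν‖ ≤ ‖emb (fun l => (S l)⁻¹) (fun _ => Pi.single μ 1) l‖ := by
        have := PiLp.norm_apply_le (emb (fun l => (S l)⁻¹) (fun _ => Pi.single μ 1) l) ν
        simpa [emb] using this
      exact mul_le_mul h4 h5 (norm_nonneg _) ((norm_nonneg _).trans h4)
  refine (memLp_finsetSum Finset.univ fun μ _ => hμ μ).ae_eq ?_
  filter_upwards [H.root.ae] with l ⟨_, _, hu⟩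
  have : wiener f g a l ν = ((wiener f g a l ᵥ* S l) ᵥ* (S l)⁻¹) ν := by
    rw [Matrix.vecMul_vecMul, Matrix.mul_nonsing_inv _ hu, Matrix.vecMul_one]
  rw [this]; rfl

/-- As `f + g` is bounded, `w ↦ wᵀ (f + g)` maps `L₂(f + g)` into the unweighted `L²`. -/
theorem memLp_vecMul {w : ℝ → Fin T → ℂ} (hwm : ∀ ν, AEStronglyMeasurable (fun l => w l ν) circ)
    (hw : MemLp (emb S w) 2 circ) (ν : Fin T) :
    MemLp (fun l => (w l ᵥ* (f l + g l)) ν) 2 circ := by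
  refine hw.of_le_mul (c := M) ?_ ?_
  · exact aestronglyMeasurable_vecMul
      (fun ν μ => (H.integrable_left ν μ).1.add (H.integrable_right ν μ).1) hwm ν
  · filter_upwards [H.norm_vecMul_le, H.root.ae] with l h1 ⟨_, h2, _⟩
    have h3 := (PiLp.norm_apply_le (WithLp.toLp 2 ((w l ᵥ* S l) ᵥ* S l) :
      EuclideanSpace ℂ (Fin T)) ν).trans (h1 _)
    rw [Matrix.vecMul_vecMul, h2] at h3
    exact h3

theorem integrable_wiener_entry (μ ν : Fin T) :
    Integrable (fun l => (f l * (f l + g l)⁻¹) μ ν) circ := by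
  have h := (H.memLp_wiener (a := fun _ => Pi.single μ 1) (fun _ => aestronglyMeasurable_const)
    (fun _ => le_rfl) ν).integrable (by norm_num)
  refine h.congr (Eventually.of_forall fun l => ?_)
  simp only [wiener, Matrix.single_one_vecMul]
  rfl

theorem integrable_parallelSum_entry (μ ν : Fin T) :
    Integrable (fun l => (f l * (f l + g l)⁻¹ * g l) μ ν) circ := by
  have h : ∀ μ, MemLp (emb S (wiener f g fun _ => Pi.single μ 1)) 2 circ := fun μ =>
    H.memLp_emb_wiener (fun _ => aestronglyMeasurable_const) (fun _ => le_rfl)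
  refine ((H.integrable_left μ ν).sub (H.root.integrable_form (h μ) (h ν))).congr ?_
  filter_upwards [H.posSemidef_left, H.posSemidef_right, H.isUnit_det] with l hf hg hu
  have := dotProduct_parallelSum hf.1 hg.1 hu (Pi.single μ 1) (Pi.single ν 1)
  have hs : star (Pi.single ν 1 : Fin T → ℂ) = Pi.single ν 1 := by
    rw [← Pi.single_star, star_one]
  simp only [hs, Matrix.mulVec_single_one, single_one_dotProduct, Matrix.col_apply] at this
  exact this.symm

end IsDensityPair

/-! ### The mean-square error in the spectral domain and the matrices `R`, `D` -/

theorem continuous_AN (N : ℕ) (a : ℕ → ℂ) (ν : Fin T) : Continuous fun l => AN T N a l ν :=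
  continuous_finsetSum _ fun j _ => continuous_const.mul (continuous_expi j)

theorem norm_AN_le (N : ℕ) (a : ℕ → ℂ) (l : ℝ) :
    ‖(WithLp.toLp 2 (AN T N a l) : EuclideanSpace ℂ (Fin T))‖ ≤
      ∑ j ∈ Finset.range N, ‖(WithLp.toLp 2 (avec T a j) : EuclideanSpace ℂ (Fin T))‖ := by
  have : (WithLp.toLp 2 (AN T N a l) : EuclideanSpace ℂ (Fin T)) =
      ∑ j ∈ Finset.range N, expi j l • WithLp.toLp 2 (avec T a j) := by
    ext ν
    simp [AN, mul_comm]
  rw [this]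
  refine (norm_sum_le _ _).trans (Finset.sum_le_sum fun j _ => ?_)
  rw [norm_smul, norm_expi, one_mul]

namespace IsDensityPair
variable {f g S : ℝ → Matrix (Fin T) (Fin T) ℂ} {M : ℝ} (H : IsDensityPair f g S M)
include H

theorem memLp_emb_AN (N : ℕ) (a : ℕ → ℂ) : MemLp (emb S (wiener f g (AN T N a))) 2 circ :=
  H.memLp_emb_wiener (fun ν => (continuous_AN N a ν).aestronglyMeasurable) (norm_AN_le N a)

theorem memLp_wiener_AN (N : ℕ) (a : ℕ → ℂ) (ν : Fin T) :
    MemLp (fun l => wiener f g (AN T N a) l ν) 2 circ :=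
  H.memLp_wiener (fun ν => (continuous_AN N a ν).aestronglyMeasurable) (norm_AN_le N a) ν

/-- `R_N a_N` consists of the Fourier coefficients of `A_Nᵀ f (f + g)⁻¹`. -/
theorem RNaN_eq (N : ℕ) (a : ℕ → ℂ) (k : ℤ) (ν : Fin T) :
    RNaN f g N a k ν = ∫ l, wiener f g (AN T N a) l ν * expi (-k) l ∂circ := by
  have h1 : ∀ l, wiener f g (AN T N a) l ν * expi (-k) l =
      ∑ j ∈ Finset.range N, ∑ μ, (f l * (f l + g l)⁻¹) μ ν * expi (j - k) l * avec T a j μ := by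
    intro l
    simp only [wiener, Matrix.vecMul_vecMul]
    simp only [Matrix.vecMul, dotProduct, AN, Finset.sum_mul, sub_eq_add_neg, expi_add]
    rw [Finset.sum_comm]
    exact Finset.sum_congr rfl fun j _ => Finset.sum_congr rfl fun μ _ => by ring
  have hi : ∀ (j : ℕ) (μ : Fin T), Integrable (fun l =>
      (f l * (f l + g l)⁻¹) μ ν * expi (j - k) l * avec T a j μ) circ := fun j μ =>
    (integrable_mul_expi (H.integrable_wiener_entry μ ν) _).mul_const _
  simp_rw [h1]
  rw [integral_finsetSum _ fun j _ => integrable_finsetSum _ fun μ _ => hi j μ]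
  simp only [RNaN, Finset.sum_apply]
  refine Finset.sum_congr rfl fun j _ => ?_
  rw [integral_finsetSum _ fun μ _ => hi j μ]
  simp only [Matrix.mulVec, dotProduct, Rblock, fourierBlock, Matrix.of_apply]
  exact Finset.sum_congr rfl fun μ _ => (integral_mul_const _ _).symm

/-- `⟨D_N a_N, a_N⟩` is the integral of the form of `f (f + g)⁻¹ g` at `A_N`. -/
theorem integrable_AN_parallelSum (N : ℕ) (a : ℕ → ℂ) :
    Integrable (fun l => AN T N a l ⬝ᵥ
      ((f l * (f l + g l)⁻¹ * g l) *ᵥ star (AN T N a l))) circ ∧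
    DNform f g N a = ∫ l, AN T N a l ⬝ᵥ
      ((f l * (f l + g l)⁻¹ * g l) *ᵥ star (AN T N a l)) ∂circ := by
  have h1 : (fun l => AN T N a l ⬝ᵥ ((f l * (f l + g l)⁻¹ * g l) *ᵥ star (AN T N a l))) =
      fun l => ∑ k ∈ Finset.range N, ∑ j ∈ Finset.range N, ∑ ν, ∑ μ,
        (f l * (f l + g l)⁻¹ * g l) μ ν * expi (j - k) l *
          (avec T a j μ * star (avec T a k ν)) := by
    funext l
    trans ∑ ν, ∑ μ, ∑ k ∈ Finset.range N, ∑ j ∈ Finset.range N,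
      (f l * (f l + g l)⁻¹ * g l) μ ν * expi (j - k) l * (avec T a j μ * star (avec T a k ν))
    · simp only [dotProduct, Matrix.mulVec, AN, Pi.star_apply, Finset.mul_sum]
      rw [Finset.sum_comm]
      refine Finset.sum_congr rfl fun ν _ => Finset.sum_congr rfl fun μ _ => ?_
      simp only [star_sum, star_mul', Finset.sum_mul, Finset.mul_sum, ← expi_mul_star]
      exact Finset.sum_congr rfl fun k _ => Finset.sum_congr rfl fun j _ => by ring
    · simp_rw [Finset.sum_comm (s := (Finset.univ : Finset (Fin T))) (t := Finset.range N)]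
  have hi : ∀ (k j : ℕ) (ν μ : Fin T), Integrable (fun l =>
      (f l * (f l + g l)⁻¹ * g l) μ ν * expi (j - k) l *
        (avec T a j μ * star (avec T a k ν))) circ := fun k j ν μ =>
    (integrable_mul_expi (H.integrable_parallelSum_entry μ ν) _).mul_const _
  rw [h1]
  refine ⟨integrable_finsetSum _ fun k _ => integrable_finsetSum _ fun j _ =>
    integrable_finsetSum _ fun ν _ => integrable_finsetSum _ fun μ _ => hi k j ν μ, ?_⟩
  rw [integral_finsetSum _ fun k _ => integrable_finsetSum _ fun j _ =>
    integrable_finsetSum _ fun ν _ => integrable_finsetSum _ fun μ _ => hi k j ν μ, DNform]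
  refine Finset.sum_congr rfl fun k _ => ?_
  rw [integral_finsetSum _ fun j _ =>
    integrable_finsetSum _ fun ν _ => integrable_finsetSum _ fun μ _ => hi k j ν μ]
  refine Finset.sum_congr rfl fun j _ => ?_
  rw [integral_finsetSum _ fun ν _ => integrable_finsetSum _ fun μ _ => hi k j ν μ]
  simp only [Dblock, fourierBlock, Matrix.mulVec, dotProduct, Matrix.of_apply, Finset.sum_mul,
    Pi.star_apply]
  refine Finset.sum_congr rfl fun ν _ => ?_
  rw [integral_finsetSum _ fun μ _ => hi k j ν μ]
  refine Finset.sum_congr rfl fun μ _ => ?_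
  rw [integral_mul_const]
  ring

/-- Forms dominated by that of `f + g` are integrable on `L₂(f + g)`. -/
theorem integrable_re_form {Φ : ℝ → Matrix (Fin T) (Fin T) ℂ}
    (hΦ : ∀ ν μ, AEStronglyMeasurable (fun l => Φ l ν μ) circ)
    (hle : ∀ᵐ l ∂circ, ∀ x : Fin T → ℂ, 0 ≤ (x ⬝ᵥ (Φ l *ᵥ star x)).re ∧
      (x ⬝ᵥ (Φ l *ᵥ star x)).re ≤ (x ⬝ᵥ ((f l + g l) *ᵥ star x)).re)
    {u : ℝ → Fin T → ℂ} (hum : ∀ ν, AEStronglyMeasurable (fun l => u l ν) circ)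
    (hu : MemLp (emb S u) 2 circ) :
    Integrable (fun l => (u l ⬝ᵥ (Φ l *ᵥ star (u l))).re) circ := by
  refine (H.root.integrable_form hu hu).re.mono ?_ ?_
  · refine Complex.continuous_re.comp_aestronglyMeasurable ?_
    simp only [dotProduct, Matrix.mulVec, Pi.star_apply]
    exact Finset.aestronglyMeasurable_fun_sum _ fun ν _ => (hum ν).mul
      (Finset.aestronglyMeasurable_fun_sum _ fun μ _ => (hΦ ν μ).mul
        (continuous_star.comp_aestronglyMeasurable (hum μ)))
  · filter_upwards [hle] with l h
    rw [Real.norm_of_nonneg (h _).1, RCLike.re_eq_complex_re,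
      Real.norm_of_nonneg ((h _).1.trans (h _).2)]
    exact (h _).2

theorem re_form_left_le : ∀ᵐ l ∂circ, ∀ x : Fin T → ℂ, 0 ≤ (x ⬝ᵥ (f l *ᵥ star x)).re ∧
    (x ⬝ᵥ (f l *ᵥ star x)).re ≤ (x ⬝ᵥ ((f l + g l) *ᵥ star x)).re := by
  filter_upwards [H.posSemidef_left, H.posSemidef_right] with l hf hg x
  have h1 := (Complex.le_def.1 (hf.dotProduct_mulVec_star_nonneg x)).1
  have h2 := (Complex.le_def.1 (hg.dotProduct_mulVec_star_nonneg x)).1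
  rw [Matrix.add_mulVec, dotProduct_add, Complex.add_re]
  simp only [Complex.zero_re] at h1 h2
  exact ⟨h1, by linarith⟩

theorem re_form_right_le : ∀ᵐ l ∂circ, ∀ x : Fin T → ℂ, 0 ≤ (x ⬝ᵥ (g l *ᵥ star x)).re ∧
    (x ⬝ᵥ (g l *ᵥ star x)).re ≤ (x ⬝ᵥ ((f l + g l) *ᵥ star x)).re := by
  filter_upwards [H.posSemidef_left, H.posSemidef_right] with l hf hg x
  have h1 := (Complex.le_def.1 (hf.dotProduct_mulVec_star_nonneg x)).1
  have h2 := (Complex.le_def.1 (hg.dotProduct_mulVec_star_nonneg x)).1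
  rw [Matrix.add_mulVec, dotProduct_add, Complex.add_re]
  simp only [Complex.zero_re] at h1 h2
  exact ⟨h2, by linarith⟩

/-- The mean-square error of `h` is the squared distance of `h` from the unconstrained optimum plus
the error `⟨D_N a_N, a_N⟩` of the latter. -/
theorem mse_eq (N : ℕ) (a : ℕ → ℂ) {h : ℝ → Fin T → ℂ}
    (hm : ∀ ν, AEStronglyMeasurable (fun l => h l ν) circ) (hh : MemLp (emb S h) 2 circ) :
    (mse f g (AN T N a) h : ℂ) =
      ((‖hh.toLp - (H.memLp_emb_AN N a).toLp‖ ^ 2 : ℝ) : ℂ) + DNform f g N a := by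
  have hAm : ∀ ν, AEStronglyMeasurable (fun l => AN T N a l ν) circ := fun ν =>
    (continuous_AN N a ν).aestronglyMeasurable
  have hA : MemLp (emb S (AN T N a)) 2 circ := H.memLp_emb_of_bounded hAm (norm_AN_le N a)
  have hAh : MemLp (emb S (AN T N a - h)) 2 circ := by rw [emb_sub]; exact hA.sub hh
  have hd : MemLp (emb S (h - wiener f g (AN T N a))) 2 circ := by
    rw [emb_sub]; exact hh.sub (H.memLp_emb_AN N a)
  have i1 := H.integrable_re_form (u := AN T N a - h) (fun ν μ => (H.integrable_left ν μ).1)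
    H.re_form_left_le
    (fun ν => (hAm ν).sub (hm ν)) hAh
  have i2 := H.integrable_re_form (fun ν μ => (H.integrable_right ν μ).1) H.re_form_right_le hm hh
  obtain ⟨i3, hD⟩ := H.integrable_AN_parallelSum N a
  simp only [Pi.sub_apply] at i1
  rw [hD, mse, ← integral_add i1 i2, ← integral_complex_ofReal]
  have e1 : ((‖hh.toLp - (H.memLp_emb_AN N a).toLp‖ ^ 2 : ℝ) : ℂ) =
      ∫ l, (h - wiener f g (AN T N a)) l ⬝ᵥ
        ((f l + g l) *ᵥ star ((h - wiener f g (AN T N a)) l)) ∂circ := by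
    rw [H.root.integral_form hd hd, inner_self_eq_norm_sq_to_K, ← MemLp.toLp_sub]
    push_cast
    congr 4
    simp [emb_sub]
  rw [e1, ← integral_add (H.root.integrable_form hd hd) i3]
  refine integral_congr_ae ?_
  filter_upwards [H.posSemidef_left, H.posSemidef_right, H.isUnit_det] with l hf hg hu
  have h1 := dotProduct_complete_square hf.1 hg.1 hu (AN T N a l) (h l)
  have h2 := (Complex.le_def.1 (hf.dotProduct_mulVec_star_nonneg (AN T N a l - h l))).2
  have h3 := (Complex.le_def.1 (hg.dotProduct_mulVec_star_nonneg (h l))).2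
  refine Eq.trans ?_ h1
  apply Complex.ext
  · rw [Complex.ofReal_re, Complex.add_re]
  · rw [Complex.ofReal_im, Complex.add_im, ← h2, ← h3, Complex.zero_im, add_zero]

end IsDensityPair

/-! ### Linear combinations of families indexed by blocks -/

section comb
variable {V W : Type*} [AddCommGroup V] [Module ℂ V] [AddCommGroup W] [Module ℂ W]

/-- The linear combination `∑_j ∑_ν p(j)_ν x_ν(j)` of a family `x` of vectors. -/
noncomputable def comb (x : ℤ → Fin T → V) : (ℤ →₀ (Fin T → ℂ)) →ₗ[ℂ] V :=
  Finsupp.lsum ℂ fun j => ∑ ν, (LinearMap.proj ν : (Fin T → ℂ) →ₗ[ℂ] ℂ).smulRight (x j ν)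

theorem comb_apply (x : ℤ → Fin T → V) (p : ℤ →₀ (Fin T → ℂ)) :
    comb x p = ∑ j ∈ p.support, ∑ ν, p j ν • x j ν := by
  simp [comb, Finsupp.sum]

theorem comb_single (x : ℤ → Fin T → V) (j : ℤ) (ν : Fin T) :
    comb x (Finsupp.single j (Pi.single ν 1)) = x j ν := by
  simp [comb, Pi.single_apply, ite_smul]

theorem map_comb (L : V →ₗ[ℂ] W) (x : ℤ → Fin T → V) (p : ℤ →₀ (Fin T → ℂ)) :
    L (comb x p) = comb (fun j ν => L (x j ν)) p := by
  simp [comb_apply]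

/-- The span of the vectors `x_ν(j)`, `j ∈ O`. -/
noncomputable def combSpan (x : ℤ → Fin T → V) (O : Set ℤ) : Submodule ℂ V :=
  (Finsupp.supported (Fin T → ℂ) ℂ O).map (comb x)

theorem mem_combSpan {x : ℤ → Fin T → V} {O : Set ℤ} {v : V} :
    v ∈ combSpan x O ↔ ∃ p : ℤ →₀ (Fin T → ℂ), (p.support : Set ℤ) ⊆ O ∧ comb x p = v := Iff.rfl

theorem apply_mem_combSpan (x : ℤ → Fin T → V) {O : Set ℤ} {j : ℤ} (hj : j ∈ O) (ν : Fin T) :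
    x j ν ∈ combSpan x O := by
  refine mem_combSpan.2 ⟨_, ?_, comb_single x j ν⟩
  refine (Finset.coe_subset.2 Finsupp.support_single_subset).trans ?_
  simpa using hj

end comb

section inner
variable {V W : Type*} [NormedAddCommGroup V] [InnerProductSpace ℂ V] [NormedAddCommGroup W]
  [InnerProductSpace ℂ W]

theorem inner_comb_left (x : ℤ → Fin T → V) (p : ℤ →₀ (Fin T → ℂ)) (v : V) :
    inner ℂ (comb x p) v = ∑ j ∈ p.support, ∑ ν, star (p j ν) * inner ℂ (x j ν) v := by
  simp [comb_apply, mul_comm]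

theorem inner_comb_congr {x : ℤ → Fin T → V} {z : ℤ → Fin T → W} {v : V} {w : W}
    (h : ∀ j ν, inner ℂ (x j ν) v = inner ℂ (z j ν) w) (p : ℤ →₀ (Fin T → ℂ)) :
    inner ℂ (comb x p) v = inner ℂ (comb z p) w := by
  simp only [inner_comb_left, h]

/-- Families with the same Gram matrix have isometric spans. -/
theorem norm_comb_eq {x : ℤ → Fin T → V} {z : ℤ → Fin T → W}
    (h : ∀ j ν k μ, inner ℂ (x j ν) (x k μ) = inner ℂ (z j ν) (z k μ)) (p : ℤ →₀ (Fin T → ℂ)) :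
    ‖comb x p‖ = ‖comb z p‖ := by
  have h1 : inner ℂ (comb x p) (comb x p) = inner ℂ (comb z p) (comb z p) := by
    refine inner_comb_congr (fun j ν => ?_) p
    rw [← inner_conj_symm, ← inner_conj_symm (z j ν)]
    congr 1
    exact inner_comb_congr (fun k μ => h k μ j ν) p
  rw [inner_self_eq_norm_sq_to_K, inner_self_eq_norm_sq_to_K] at h1
  have h2 : ‖comb x p‖ ^ 2 = ‖comb z p‖ ^ 2 := by exact_mod_cast h1
  exact (pow_left_inj₀ (norm_nonneg _) (norm_nonneg _) two_ne_zero).1 h2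

theorem mem_combSpan_orthogonal {x : ℤ → Fin T → V} {O : Set ℤ} {v : V} :
    v ∈ (combSpan x O)ᗮ ↔ ∀ j ∈ O, ∀ ν, inner ℂ (x j ν) v = 0 := by
  refine ⟨fun h j hj ν => h _ (apply_mem_combSpan x hj ν), fun h => ?_⟩
  rintro _ ⟨p, hp, rfl⟩
  rw [inner_comb_left]
  exact Finset.sum_eq_zero fun j hj => Finset.sum_eq_zero fun ν _ => by rw [h j (hp hj), mul_zero]

end inner

theorem coeFn_comb {α E : Type*} [MeasurableSpace α] {μ : Measure α} [NormedAddCommGroup E]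
    [NormedSpace ℂ E] {x : ℤ → Fin T → α → E} (hx : ∀ j ν, MemLp (x j ν) 2 μ)
    (p : ℤ →₀ (Fin T → ℂ)) :
    comb x p =ᵐ[μ] (comb (fun j ν => (hx j ν).toLp) p : Lp E 2 μ) := by
  let Q : Submodule ℂ ((α → E) × Lp E 2 μ) :=
    { carrier := {q | q.1 =ᵐ[μ] q.2}
      add_mem' := fun {q q'} (h1 : q.1 =ᵐ[μ] q.2) (h2 : q'.1 =ᵐ[μ] q'.2) =>
        (h1.add h2).trans (Lp.coeFn_add _ _).symm
      zero_mem' := (Lp.coeFn_zero E 2 μ).symm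
      smul_mem' := fun z q (h : q.1 =ᵐ[μ] q.2) => (h.const_smul z).trans (Lp.coeFn_smul _ _).symm }
  have h : comb (fun j ν => (x j ν, (hx j ν).toLp)) p ∈ Q := by
    rw [comb_apply]
    exact Q.sum_mem fun j _ => Q.sum_mem fun ν _ => Q.smul_mem _ (hx j ν).coeFn_toLp.symm
  have h1 := map_comb (LinearMap.fst ℂ (α → E) (Lp E 2 μ)) (fun j ν => (x j ν, (hx j ν).toLp)) p
  have h2 := map_comb (LinearMap.snd ℂ (α → E) (Lp E 2 μ)) (fun j ν => (x j ν, (hx j ν).toLp)) p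
  simp only [LinearMap.fst_apply, LinearMap.snd_apply] at h1 h2
  rw [← h1, ← h2]
  exact h

theorem toLp_comb {α E : Type*} [MeasurableSpace α] {μ : Measure α} [NormedAddCommGroup E]
    [NormedSpace ℂ E] {x : ℤ → Fin T → α → E} (hx : ∀ j ν, MemLp (x j ν) 2 μ)
    (p : ℤ →₀ (Fin T → ℂ)) :
    ∃ h : MemLp (comb x p) 2 μ, h.toLp = comb (fun j ν => (hx j ν).toLp) p :=
  ⟨(Lp.memLp _).ae_eq (coeFn_comb hx p).symm,
    Lp.ext ((MemLp.coeFn_toLp _).trans (coeFn_comb hx p))⟩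

/-! ### The subspace `L₂ˢ(f + g)` -/

/-- The vector function `e^{ijλ} δ_ν`. -/
noncomputable def expVec (j : ℤ) (ν : Fin T) (l : ℝ) : Fin T → ℂ := Pi.single ν (expi j l)

theorem trigPoly_eq_comb (p : ℤ →₀ (Fin T → ℂ)) : trigPoly p = comb expVec p := by
  funext l ν
  rw [comb_apply]
  simp [trigPoly, expVec, Pi.single_apply]

/-- `emb S` as a linear map. -/
noncomputable def embₗ (S : ℝ → Matrix (Fin T) (Fin T) ℂ) :
    (ℝ → Fin T → ℂ) →ₗ[ℂ] (ℝ → EuclideanSpace ℂ (Fin T)) where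
  toFun := emb S
  map_add' := emb_add S
  map_smul' := emb_smul S

theorem emb_trigPoly (S : ℝ → Matrix (Fin T) (Fin T) ℂ) (p : ℤ →₀ (Fin T → ℂ)) :
    emb S (trigPoly p) = comb (fun j ν => emb S (expVec j ν)) p := by
  rw [trigPoly_eq_comb]; exact map_comb (embₗ S) _ _

theorem aestronglyMeasurable_expVec (j : ℤ) (ν μ : Fin T) :
    AEStronglyMeasurable (fun l => expVec j ν l μ) circ := by
  by_cases h : μ = ν
  · subst h; simpa [expVec] using (continuous_expi j).aestronglyMeasurable
  · simpa [expVec, h] using aestronglyMeasurable_const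

theorem aestronglyMeasurable_trigPoly (p : ℤ →₀ (Fin T → ℂ)) (ν : Fin T) :
    AEStronglyMeasurable (fun l => trigPoly p l ν) circ :=
  (continuous_finsetSum _ fun j _ =>
    continuous_const.mul (continuous_expi j)).aestronglyMeasurable

namespace IsDensityPair
variable {f g S : ℝ → Matrix (Fin T) (Fin T) ℂ} {M : ℝ} (H : IsDensityPair f g S M)
include H

theorem memLp_expVec (j : ℤ) (ν : Fin T) : MemLp (emb S (expVec j ν)) 2 circ := by
  refine H.memLp_emb_of_bounded (c := 1) (aestronglyMeasurable_expVec j ν) fun l => ?_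
  simp [expVec, norm_expi]

/-- The functions `e^{ijλ} δ_ν` of `L₂(f + g)`, embedded into the unweighted `L²`. -/
noncomputable def expEmb (j : ℤ) (ν : Fin T) : Lp (EuclideanSpace ℂ (Fin T)) 2 circ :=
  (H.memLp_expVec j ν).toLp

/-- The pairing of `L₂(f + g)` against `e^{ijλ} δ_ν`. -/
theorem inner_expEmb (j : ℤ) (ν : Fin T) {w : ℝ → Fin T → ℂ} (hw : MemLp (emb S w) 2 circ) :
    inner ℂ (H.expEmb j ν) hw.toLp = ∫ l, (w l ᵥ* (f l + g l)) ν * expi (-j) l ∂circ := by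
  rw [expEmb, ← H.root.integral_form hw (H.memLp_expVec j ν)]
  congr 1
  funext l
  have : star (expVec j ν l) = Pi.single ν (expi (-j) l) := by
    rw [expVec, ← Pi.single_star, star_expi]
  rw [this, Matrix.dotProduct_mulVec]
  simp

theorem energy_sub_trigPoly {h : ℝ → Fin T → ℂ} (hh : MemLp (emb S h) 2 circ)
    (p : ℤ →₀ (Fin T → ℂ)) :
    energy (fun l => f l + g l) (fun l => h l - trigPoly p l) =
      edist hh.toLp (comb H.expEmb p) ^ 2 := by
  obtain ⟨h1, h2⟩ := toLp_comb H.memLp_expVec p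
  have : comb H.expEmb p = h1.toLp := h2.symm
  rw [this, Lp.edist_toLp_toLp, ← emb_trigPoly, ← emb_sub, ← H.root.energy_eq]
  rfl

theorem memLp_emb_trigPoly (p : ℤ →₀ (Fin T → ℂ)) : MemLp (emb S (trigPoly p)) 2 circ := by
  rw [emb_trigPoly]; exact (toLp_comb H.memLp_expVec p).1

/-- A measurable function at finite distance from a trigonometric polynomial is in `L₂(f + g)`. -/
theorem memLp_emb_of_energy_sub {h : ℝ → Fin T → ℂ}
    (hm : ∀ ν, AEStronglyMeasurable (fun l => h l ν) circ) {p : ℤ →₀ (Fin T → ℂ)}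
    (hp : energy (fun l => f l + g l) (fun l => h l - trigPoly p l) < ∞) :
    MemLp (emb S h) 2 circ := by
  have h1 := H.root.memLp_emb (fun ν => (hm ν).sub (aestronglyMeasurable_trigPoly p ν)) hp
  have h2 : MemLp (emb S (h - trigPoly p)) 2 circ := h1
  rw [emb_sub] at h2
  simpa using h2.add (H.memLp_emb_trigPoly p)

/-- `L₂ˢ(f + g)` corresponds to the closed span of the embedded `e^{ijλ} δ_ν`, `j ∈ O`. -/
theorem memL2s_iff {O : Set ℤ} {h : ℝ → Fin T → ℂ} :
    MemL2s (fun l => f l + g l) O h ↔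
      (∀ ν, AEStronglyMeasurable (fun l => h l ν) circ) ∧
        ∃ hh : MemLp (emb S h) 2 circ, hh.toLp ∈ (combSpan H.expEmb O).topologicalClosure := by
  refine and_congr_right fun hm => ⟨fun hp => ?_, fun ⟨hh, hcl⟩ ε hε => ?_⟩
  · obtain ⟨p₀, -, hp₀⟩ := hp 1 one_pos
    have hh := H.memLp_emb_of_energy_sub hm (hp₀.trans_lt ENNReal.one_lt_top)
    refine ⟨hh, ?_⟩
    rw [← SetLike.mem_coe, Submodule.topologicalClosure_coe, EMetric.mem_closure_iff]
    intro ε hε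
    obtain ⟨δ, hδ, hδε⟩ := exists_between hε
    obtain ⟨p, hpO, hpe⟩ := hp (δ ^ 2) (by positivity)
    refine ⟨_, mem_combSpan.2 ⟨p, hpO, rfl⟩, lt_of_le_of_lt ?_ hδε⟩
    rw [H.energy_sub_trigPoly hh] at hpe
    exact (ENNReal.pow_le_pow_left_iff two_ne_zero).1 hpe
  · rw [← SetLike.mem_coe, Submodule.topologicalClosure_coe, EMetric.mem_closure_iff] at hcl
    obtain ⟨δ, hδ, hδε⟩ : ∃ δ : ℝ≥0∞, 0 < δ ∧ δ ^ 2 ≤ ε := by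
      refine ⟨min ε 1, lt_min hε one_pos, ?_⟩
      rw [sq]
      calc min ε 1 * min ε 1 ≤ ε * 1 := mul_le_mul' (min_le_left _ _) (min_le_right _ _)
        _ = ε := mul_one _
    obtain ⟨_, ⟨p, hpO, rfl⟩, hd⟩ := hcl δ hδ
    refine ⟨p, hpO, ?_⟩
    rw [H.energy_sub_trigPoly hh]
    exact (pow_le_pow_left' hd.le 2).trans hδε

/-! ### `h_N` is the projection of the unconstrained optimum onto `L₂ˢ(f + g)` -/

theorem memLp_emb_vecMul_inv {C : ℝ → Fin T → ℂ} (hC : MemLp (emb (fun l => (S l)⁻¹) C) 2 circ) :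
    MemLp (emb S fun l => C l ᵥ* (f l + g l)⁻¹) 2 circ :=
  hC.ae_eq (H.root.emb_vecMul_inv C).symm

theorem toLp_emb_vecMul_inv {C : ℝ → Fin T → ℂ}
    (hC : MemLp (emb (fun l => (S l)⁻¹) C) 2 circ) :
    (H.memLp_emb_vecMul_inv hC).toLp = hC.toLp :=
  MemLp.toLp_congr _ _ (H.root.emb_vecMul_inv C)

theorem memLp_emb_hN (N : ℕ) (a : ℕ → ℂ) {C : ℝ → Fin T → ℂ}
    (hC : MemLp (emb (fun l => (S l)⁻¹) C) 2 circ) : MemLp (emb S (hN f g N a C)) 2 circ := by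
  rw [hN_eq, emb_sub]
  exact (H.memLp_emb_AN N a).sub (H.memLp_emb_vecMul_inv hC)

theorem toLp_emb_hN (N : ℕ) (a : ℕ → ℂ) {C : ℝ → Fin T → ℂ}
    (hC : MemLp (emb (fun l => (S l)⁻¹) C) 2 circ) :
    (H.memLp_emb_hN N a hC).toLp = (H.memLp_emb_AN N a).toLp - hC.toLp := by
  rw [← H.toLp_emb_vecMul_inv hC, ← MemLp.toLp_sub]
  refine MemLp.toLp_congr _ _ (Eventually.of_forall fun l => ?_)
  rw [hN_eq, emb_sub]

/-- The difference `C (f + g)⁻¹` between the unconstrained optimum and `h_N` is orthogonal to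
`L₂ˢ(f + g)`, since the Fourier coefficients of `C` vanish off `G`. -/
theorem inner_expEmb_series {G : Set ℤ} {c : Seq2 T G} {C : ℝ → Fin T → ℂ} (hs : IsSeries c C)
    (hC : MemLp (emb (fun l => (S l)⁻¹) C) 2 circ) {j : ℤ} (hj : j ∉ G) (ν : Fin T) :
    inner ℂ (H.expEmb j ν) hC.toLp = 0 := by
  rw [← H.toLp_emb_vecMul_inv hC, inner_expEmb, ← hs.integral_mul_expi_eq_zero hj ν]
  refine integral_congr_ae ?_
  filter_upwards [H.isUnit_det] with l hl
  rw [Matrix.vecMul_vecMul, Matrix.nonsing_inv_mul _ hl, Matrix.vecMul_one]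

/-- `h_N` is in `L₂ˢ(f + g)`: it is orthogonal to every `w` orthogonal to `L₂ˢ(f + g)`, because
`wᵀ (f + g)` is then a series over `G` of finite energy, against which `B c = R_N a_N` is tested. -/
theorem toLp_emb_hN_mem {G O : Set ℤ} (hGO : Gᶜ = O) (N : ℕ) (a : ℕ → ℂ) {r : Seq2 T G}
    (hr : ∀ k ν, r k ν = RNaN f g N a k ν) {C : ℝ → Fin T → ℂ}
    (hC : MemLp (emb (fun l => (S l)⁻¹) C) 2 circ)
    (hq : ∀ d D, IsSeries d D → energy (fun l => (f l + g l)⁻¹) D < ∞ →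
      Bform f g C D = inner ℂ d r) :
    (H.memLp_emb_hN N a hC).toLp ∈ (combSpan H.expEmb O).topologicalClosure := by
  rw [← Submodule.orthogonal_orthogonal_eq_closure]
  intro w hw
  rw [mem_combSpan_orthogonal] at hw
  obtain ⟨v, hvm, hvw⟩ := H.root.exists_emb_eq w
  have hv : MemLp (emb S v) 2 circ := (Lp.memLp w).ae_eq hvw.symm
  have hvw' : hv.toLp = w := by
    rw [← Lp.toLp_coeFn w (Lp.memLp w)]; exact MemLp.toLp_congr _ _ hvw
  have hE : MemLp (emb (fun l => (S l)⁻¹) fun l => v l ᵥ* (f l + g l)) 2 circ :=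
    hv.ae_eq (H.root.emb_vecMul v).symm
  have hEw : hE.toLp = w := by
    rw [← hvw']; exact MemLp.toLp_congr _ _ (H.root.emb_vecMul v)
  obtain ⟨d, hd⟩ := exists_isSeries (G := G) (H.memLp_vecMul hvm hv) fun k hk ν => by
    rw [← H.inner_expEmb k ν hv, hvw']
    exact hw k (hGO ▸ hk) ν
  have h1 := hq d _ hd (H.root.inv.energy_lt_top hE)
  rw [Bform_eq_inner H.root hC hE, hEw, hd.inner_eq (H.memLp_wiener_AN N a)
    fun k ν => by rw [hr, H.RNaN_eq]] at h1
  rw [H.toLp_emb_hN N a hC, inner_sub_right, h1, sub_eq_zero, ← hvw',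
    ← H.root.integral_form (H.memLp_emb_AN N a) hv]
  refine integral_congr_ae ?_
  filter_upwards [H.posSemidef_left, H.posSemidef_right] with l hf hg
  rw [Matrix.star_vecMul, (hf.1.add hg.1).eq]

end IsDensityPair

/-! ### Projections onto spans of families with the same Gram matrix -/

section transfer
variable {V W : Type*} [NormedAddCommGroup V] [InnerProductSpace ℂ V] [NormedAddCommGroup W]
  [InnerProductSpace ℂ W]

theorem norm_sub_sq_of_mem_orthogonal {K : Submodule ℂ V} {v y y' : V}
    (hy : y ∈ K.topologicalClosure) (hy' : y' ∈ K.topologicalClosure) (hv : v - y ∈ Kᗮ) :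
    ‖v - y'‖ ^ 2 = ‖v - y‖ ^ 2 + ‖y - y'‖ ^ 2 := by
  rw [← Submodule.orthogonal_closure] at hv
  have h0 : inner ℂ (v - y) (y - y') = 0 :=
    Submodule.inner_left_of_mem_orthogonal (sub_mem hy hy') hv
  have := norm_add_sq_eq_norm_sq_add_norm_sq_of_inner_eq_zero (𝕜 := ℂ) (v - y) (y - y') h0
  rw [sub_add_sub_cancel] at this
  rw [sq, sq, sq, this]

/-- The projection of `v` onto a closed span is carried, by the isometry which maps the family `x`
to the family `z` with the same Gram matrix, to the projection of any `w` with the same pairings. -/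
theorem exists_transfer [CompleteSpace W] {x : ℤ → Fin T → V} {z : ℤ → Fin T → W} {O : Set ℤ}
    (hxz : ∀ j ν k μ, inner ℂ (x j ν) (x k μ) = inner ℂ (z j ν) (z k μ)) {v h : V} {w : W} {D : ℝ}
    (hvw : ∀ j ν, inner ℂ (x j ν) v = inner ℂ (z j ν) w) (hD : ‖w‖ ^ 2 = ‖v‖ ^ 2 + D)
    (hh : h ∈ (combSpan x O).topologicalClosure) (hv : v - h ∈ (combSpan x O)ᗮ) :
    ∃ X ∈ (combSpan z O).topologicalClosure, w - X ∈ (combSpan z O)ᗮ ∧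
      ‖w - X‖ ^ 2 = ‖v - h‖ ^ 2 + D ∧ ∀ p, ‖X - comb z p‖ = ‖h - comb x p‖ := by
  rw [← SetLike.mem_coe, Submodule.topologicalClosure_coe, mem_closure_iff_seq_limit] at hh
  obtain ⟨y, hy, hlim⟩ := hh
  choose p hpO hp using fun n => mem_combSpan.1 (hy n)
  have hnorm : ∀ q q', ‖comb z q - comb z q'‖ = ‖comb x q - comb x q'‖ := fun q q' => by
    rw [← map_sub, ← map_sub, norm_comb_eq hxz]
  have hc : CauchySeq fun n => comb z (p n) := by
    rw [Metric.cauchySeq_iff']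
    intro ε hε
    obtain ⟨n₀, hn₀⟩ := Metric.cauchySeq_iff'.1 hlim.cauchySeq ε hε
    refine ⟨n₀, fun n hn => ?_⟩
    rw [dist_eq_norm, hnorm, hp, hp, ← dist_eq_norm]
    exact hn₀ n hn
  obtain ⟨X, hX⟩ := cauchySeq_tendsto_of_complete hc
  have hdist : ∀ q, ‖X - comb z q‖ = ‖h - comb x q‖ := fun q => by
    have h1 := (hX.sub_const (comb z q)).norm
    have h2 := (hlim.sub_const (comb x q)).norm
    simp only [hnorm, hp] at h1
    exact tendsto_nhds_unique h1 h2
  have hpair : ∀ j ν, inner ℂ (z j ν) X = inner ℂ (x j ν) h := fun j ν => by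
    have h1 : Tendsto (fun n => inner ℂ (z j ν) (comb z (p n))) atTop (𝓝 (inner ℂ (z j ν) X)) :=
      tendsto_const_nhds.inner hX
    have h2 : Tendsto (fun n => inner ℂ (x j ν) (y n)) atTop (𝓝 (inner ℂ (x j ν) h)) :=
      tendsto_const_nhds.inner hlim
    refine tendsto_nhds_unique h1 (h2.congr fun n => ?_)
    rw [← hp n, ← inner_conj_symm, ← inner_conj_symm (z j ν)]
    congr 1
    exact inner_comb_congr (fun k μ => hxz k μ j ν) (p n)
  have hXK : X ∈ (combSpan z O).topologicalClosure := by
    rw [← SetLike.mem_coe, Submodule.topologicalClosure_coe]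
    exact mem_closure_of_tendsto hX
      (Eventually.of_forall fun n => mem_combSpan.2 ⟨p n, hpO n, rfl⟩)
  have hhK : h ∈ (combSpan x O).topologicalClosure := by
    rw [← SetLike.mem_coe, Submodule.topologicalClosure_coe]
    exact mem_closure_of_tendsto hlim (Eventually.of_forall hy)
  have hw : w - X ∈ (combSpan z O)ᗮ := by
    rw [mem_combSpan_orthogonal] at hv ⊢
    intro j hj ν
    rw [inner_sub_right, hpair, ← hvw, ← inner_sub_right]
    exact hv j hj ν
  refine ⟨X, hXK, hw, ?_, hdist⟩
  have e1 := norm_sub_sq_of_mem_orthogonal hXK (zero_mem _) hw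
  have e2 := norm_sub_sq_of_mem_orthogonal hhK (zero_mem _) hv
  have e3 := hdist 0
  simp only [map_zero, sub_zero] at e1 e2 e3
  rw [e3] at e1
  linarith

end transfer

/-! ### Times and blocks -/

theorem mem_observed_iff (T s : ℕ) (Nobs Kmis : ℕ → ℕ) (n : ℤ) (ν : Fin T) :
    n * T + (ν : ℤ) + 1 ∈ observed T s Nobs Kmis ↔ n ∈ observedBlocks s Nobs Kmis := by
  have hν : (ν : ℤ) < T := by exact_mod_cast ν.2
  have h0 : (0 : ℤ) ≤ ν := by positivity
  have key : ∀ m : ℤ, n * T + (ν : ℤ) + 1 ≤ m * T ↔ n ≤ m - 1 := fun m => by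
    constructor
    · intro h
      by_contra! h'
      nlinarith
    · intro h
      nlinarith
  have key' : ∀ m : ℤ, m * T + 1 ≤ n * T + (ν : ℤ) + 1 ↔ m ≤ n := fun m => by
    constructor
    · intro h
      by_contra! h'
      nlinarith
    · intro h
      nlinarith
  simp only [observed, observedBlocks, missing, missingBlocks, Set.mem_sdiff, Set.mem_Iic,
    Set.mem_iUnion, Set.mem_Icc, ← sub_mul, key, key']
  have := key 0
  rw [zero_mul] at this
  rw [this]; simp

theorem compl_Gam (s : ℕ) (Nobs Kmis : ℕ → ℕ) :
    (Gam s Nobs Kmis)ᶜ = observedBlocks s Nobs Kmis := by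
  ext n
  simp only [Gam, observedBlocks, Set.mem_compl_iff, Set.mem_union, Set.mem_Ici, Set.mem_sdiff,
    Set.mem_Iic, not_or, not_le]
  rw [and_comm, Int.lt_iff_add_one_le]
  refine and_congr_left fun _ => ?_
  omega

theorem exists_block_index {T : ℕ} (hT : 0 < T) (j : ℤ) :
    ∃ (n : ℤ) (ν : Fin T), j = n * T + (ν : ℤ) + 1 := by
  have hT' : (0 : ℤ) < T := by exact_mod_cast hT
  have h1 := Int.emod_nonneg (j - 1) hT'.ne'
  have h2 := Int.emod_lt_of_pos (j - 1) hT'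
  refine ⟨(j - 1) / T, ⟨((j - 1) % T).toNat, by omega⟩, ?_⟩
  have h3 := Int.mul_ediv_add_emod (j - 1) T
  simp only [Int.toNat_of_nonneg h1]
  linarith [mul_comm (T : ℤ) ((j - 1) / T)]

theorem functional_eq {Ω : Type*} (T N : ℕ) (a : ℕ → ℂ) (ζ : ℤ → Ω → ℂ) :
    functional T N a ζ = ∑ j ∈ Finset.range N, ∑ ν : Fin T, avec T a j ν • block T ζ j ν := by
  funext ω
  simp only [functional, Finset.sum_apply, Pi.smul_apply, smul_eq_mul, block, avec]
  have h1 : ∑ j ∈ Finset.Icc 1 (N * T), a j * ζ (j : ℤ) ω =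
      ∑ i ∈ Finset.range (N * T), a (i + 1) * ζ ((i : ℤ) + 1) ω := by
    rw [Finset.sum_bij' (fun i _ => i - 1) (fun i _ => i + 1)] <;> (simp +contextual; try omega)
  rw [h1]
  clear h1
  induction N with
  | zero => simp
  | succ N ih =>
    rw [Finset.sum_range_succ, ← ih, Nat.succ_mul, Finset.sum_range_add]
    congr 1
    rw [← Fin.sum_univ_eq_sum_range (fun i => a (N * T + i + 1) * ζ (((N * T + i : ℕ) : ℤ) + 1) ω)]
    push_cast
    rfl

/-! ### The observations -/

theorem randPoly_eq_comb {Ω : Type*} {ζ θ : ℤ → Ω → ℂ} (p : ℤ →₀ (Fin T → ℂ)) :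
    randPoly ζ θ p = comb (fun j ν => block T ζ j ν + block T θ j ν) p := by
  funext ω
  rw [comb_apply]
  simp [randPoly, mul_add]

section prob
variable {Ω : Type*} [MeasurableSpace Ω] {P : Measure Ω} {ζ θ : ℤ → Ω → ℂ}

theorem inner_toLp_eq {X Y : Ω → ℂ} (hX : MemLp X 2 P) (hY : MemLp Y 2 P) :
    inner ℂ hX.toLp hY.toLp = ∫ ω, Y ω * star (X ω) ∂P := by
  rw [L2.inner_def]
  refine integral_congr_ae ?_
  filter_upwards [hX.coeFn_toLp, hY.coeFn_toLp] with ω h1 h2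
  rw [h1, h2]; rfl

theorem norm_toLp_sub_sq {X Y : Ω → ℂ} (hX : MemLp X 2 P) (hY : MemLp Y 2 P) :
    ‖hY.toLp - hX.toLp‖ ^ 2 = ∫ ω, ‖Y ω - X ω‖ ^ 2 ∂P := by
  have h := inner_toLp_eq (hY.sub hX) (hY.sub hX)
  rw [inner_self_eq_norm_sq_to_K, MemLp.toLp_sub hY hX] at h
  have h2 : (∫ ω, (Y - X) ω * star ((Y - X) ω) ∂P) = ((∫ ω, ‖Y ω - X ω‖ ^ 2 ∂P : ℝ) : ℂ) := by
    rw [← integral_complex_ofReal]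
    congr 1
    funext ω
    rw [RCLike.star_def, RCLike.mul_conj]
    push_cast
    rfl
  rw [h2] at h
  refine Complex.ofReal_injective (Eq.trans ?_ h)
  push_cast
  rfl

theorem IsPC.memLp_block (hζ : IsPC P T ζ) (j : ℤ) (ν : Fin T) : MemLp (block T ζ j ν) 2 P :=
  hζ.memLp _

/-- The observation with index `ν` in block `j`, as an element of `L²(P)`. -/
noncomputable def obs (hζ : IsPC P T ζ) (hθ : IsPC P T θ) (j : ℤ) (ν : Fin T) : Lp ℂ 2 P :=
  ((hζ.memLp_block j ν).add (hθ.memLp_block j ν)).toLp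

theorem obs_eq_add (hζ : IsPC P T ζ) (hθ : IsPC P T θ) (j : ℤ) (ν : Fin T) :
    obs hζ hθ j ν = (hζ.memLp_block j ν).toLp + (hθ.memLp_block j ν).toLp :=
  MemLp.toLp_add _ _

theorem inner_block_uncorrelated (hζ : IsPC P T ζ) (hθ : IsPC P T θ) (hunc : Uncorrelated P ζ θ)
    (j k : ℤ) (ν μ : Fin T) :
    inner ℂ (hζ.memLp_block j ν).toLp (hθ.memLp_block k μ).toLp = 0 := by
  rw [← inner_conj_symm, inner_toLp_eq, block, block, hunc, map_zero]

/-- The spectral domain and the observations have the same Gram matrix. -/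
theorem inner_obs (hζ : IsPC P T ζ) (hθ : IsPC P T θ) (hunc : Uncorrelated P ζ θ)
    {f g S : ℝ → Matrix (Fin T) (Fin T) ℂ} {M : ℝ}
    (hf : IsSpectralDensity P T ζ f) (hg : IsSpectralDensity P T θ g)
    (H : IsDensityPair f g S M) (j : ℤ) (ν : Fin T) (k : ℤ) (μ : Fin T) :
    inner ℂ (H.expEmb j ν) (H.expEmb k μ) = inner ℂ (obs hζ hθ j ν) (obs hζ hθ k μ) := by
  have e : ∀ {u : ℝ → ℂ}, Integrable u circ → Integrable (fun l => expi (k - j) l * u l) circ :=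
    fun hu => (integrable_mul_expi hu (k - j)).congr (Eventually.of_forall fun l => mul_comm _ _)
  refine (H.inner_expEmb j ν (H.memLp_expVec k μ)).trans ?_
  rw [obs_eq_add, obs_eq_add, inner_add_left, inner_add_right, inner_add_right,
    inner_block_uncorrelated hζ hθ hunc,
    ← inner_conj_symm (hθ.memLp_block j ν).toLp (hζ.memLp_block k μ).toLp,
    inner_block_uncorrelated hζ hθ hunc, inner_toLp_eq, inner_toLp_eq, hf.covariance,
    hg.covariance, map_zero, add_zero, zero_add,
    ← integral_add (e (H.integrable_left μ ν)) (e (H.integrable_right μ ν))]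
  refine integral_congr_ae (Eventually.of_forall fun l => ?_)
  simp only [expVec, Matrix.single_vecMul, Pi.smul_apply, Matrix.add_apply, smul_eq_mul,
    sub_eq_add_neg, expi_add, Matrix.row_apply]
  ring

theorem memLp_functional (hζ : IsPC P T ζ) (N : ℕ) (a : ℕ → ℂ) :
    MemLp (functional T N a ζ) 2 P :=
  memLp_finsetSum _ fun j _ => (hζ.memLp j).const_mul (a j)

theorem inner_functional_right (hζ : IsPC P T ζ) (N : ℕ) (a : ℕ → ℂ) (X : Lp ℂ 2 P) :
    inner ℂ X (memLp_functional hζ N a).toLp =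
      ∑ j ∈ Finset.range N, ∑ ν, avec T a j ν * inner ℂ X (hζ.memLp_block j ν).toLp := by
  have h : (memLp_functional hζ N a).toLp =
      ∑ q ∈ Finset.range N ×ˢ (Finset.univ : Finset (Fin T)),
        avec T a q.1 q.2 • (hζ.memLp_block q.1 q.2).toLp := by
    rw [← edist_eq_zero, edist_toLp_sum (memLp_functional hζ N a)
      (fun q : ℕ × Fin T => hζ.memLp_block q.1 q.2)]
    have : (fun ω => functional T N a ζ ω - ∑ q ∈ Finset.range N ×ˢ (Finset.univ : Finset (Fin T)),
        avec T a q.1 q.2 * block T ζ q.1 q.2 ω) = 0 := by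
      funext ω
      rw [functional_eq, Finset.sum_product]
      simp
    rw [this]; simp
  rw [h, inner_sum, Finset.sum_product]
  simp only [inner_smul_right]

theorem inner_block_functional (hζ : IsPC P T ζ)
    {f g S : ℝ → Matrix (Fin T) (Fin T) ℂ} {M : ℝ}
    (hf : IsSpectralDensity P T ζ f) (H : IsDensityPair f g S M) (N : ℕ) (a : ℕ → ℂ)
    (k : ℤ) (μ : Fin T) :
    inner ℂ (hζ.memLp_block k μ).toLp (memLp_functional hζ N a).toLp =
      ∫ l, (AN T N a l ᵥ* f l) μ * expi (-k) l ∂circ := by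
  rw [inner_functional_right hζ]
  simp_rw [inner_toLp_eq, hf.covariance]
  have hi : ∀ (j : ℕ) (ν : Fin T),
      Integrable (fun l => avec T a j ν * (expi (j - k) l * f l ν μ)) circ := fun j ν =>
    ((integrable_mul_expi (H.integrable_left ν μ) (j - k)).congr
      (Eventually.of_forall fun l => mul_comm _ _)).const_mul _
  simp_rw [← integral_const_mul]
  have h1 : ∀ l, (AN T N a l ᵥ* f l) μ * expi (-k) l =
      ∑ j ∈ Finset.range N, ∑ ν, avec T a j ν * (expi (j - k) l * f l ν μ) := by
    intro l
    simp only [Matrix.vecMul, dotProduct, AN, Finset.sum_mul, sub_eq_add_neg, expi_add]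
    rw [Finset.sum_comm]
    exact Finset.sum_congr rfl fun j _ => Finset.sum_congr rfl fun ν _ => by ring
  simp_rw [h1]
  rw [integral_finsetSum _ fun j _ => integrable_finsetSum _ fun ν _ => hi j ν]
  refine Finset.sum_congr rfl fun j _ => ?_
  rw [integral_finsetSum _ fun ν _ => hi j ν]

/-- The observations pair with `A_N ζ` as the exponentials pair with `A_Nᵀ f (f + g)⁻¹`. -/
theorem inner_obs_functional (hζ : IsPC P T ζ) (hθ : IsPC P T θ) (hunc : Uncorrelated P ζ θ)
    {f g S : ℝ → Matrix (Fin T) (Fin T) ℂ} {M : ℝ}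
    (hf : IsSpectralDensity P T ζ f) (H : IsDensityPair f g S M) (N : ℕ) (a : ℕ → ℂ)
    (k : ℤ) (μ : Fin T) :
    inner ℂ (H.expEmb k μ) (H.memLp_emb_AN N a).toLp =
      inner ℂ (obs hζ hθ k μ) (memLp_functional hζ N a).toLp := by
  have h0 : inner ℂ (hθ.memLp_block k μ).toLp (memLp_functional hζ N a).toLp = 0 := by
    rw [inner_functional_right hζ]
    refine Finset.sum_eq_zero fun j _ => Finset.sum_eq_zero fun ν _ => ?_
    rw [← inner_conj_symm, inner_block_uncorrelated hζ hθ hunc, map_zero, mul_zero]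
  rw [obs_eq_add, inner_add_left, h0, add_zero, inner_block_functional hζ hf H, H.inner_expEmb]
  refine integral_congr_ae ?_
  filter_upwards [H.isUnit_det] with l hl
  rw [wiener, Matrix.vecMul_vecMul, Matrix.nonsing_inv_mul _ hl, Matrix.vecMul_one]

/-- The variance of `A_N ζ`. -/
theorem norm_functional_sq (hζ : IsPC P T ζ)
    {f g S : ℝ → Matrix (Fin T) (Fin T) ℂ} {M : ℝ}
    (hf : IsSpectralDensity P T ζ f) (H : IsDensityPair f g S M) (N : ℕ) (a : ℕ → ℂ) :
    ((‖(memLp_functional hζ N a).toLp‖ ^ 2 : ℝ) : ℂ) =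
      ((‖(H.memLp_emb_AN N a).toLp‖ ^ 2 : ℝ) : ℂ) + DNform f g N a := by
  have hu := H.memLp_emb_AN N a
  have hum : ∀ ν, AEStronglyMeasurable (fun l => wiener f g (AN T N a) l ν) circ :=
    H.aestronglyMeasurable_wiener fun ν => (continuous_AN N a ν).aestronglyMeasurable
  have hAf : (fun l => wiener f g (AN T N a) l ᵥ* (f l + g l)) =ᵐ[circ]
      fun l => AN T N a l ᵥ* f l := by
    filter_upwards [H.isUnit_det] with l hl
    rw [wiener, Matrix.vecMul_vecMul, Matrix.nonsing_inv_mul _ hl, Matrix.vecMul_one]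
  have hint : ∀ μ, Integrable (fun l => (AN T N a l ᵥ* f l) μ) circ := fun μ => by
    refine ((H.memLp_vecMul hum hu μ).integrable (by norm_num)).congr ?_
    filter_upwards [hAf] with l hl
    rw [hl]
  have hi : ∀ (j : ℕ) (μ : Fin T), Integrable (fun l =>
      star (avec T a j μ) * ((AN T N a l ᵥ* f l) μ * expi (-j) l)) circ := fun j μ =>
    (integrable_mul_expi (hint μ) _).const_mul _
  obtain ⟨i3, hD⟩ := H.integrable_AN_parallelSum N a
  have e1 : ((‖(H.memLp_emb_AN N a).toLp‖ ^ 2 : ℝ) : ℂ) =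
      ∫ l, wiener f g (AN T N a) l ⬝ᵥ
        ((f l + g l) *ᵥ star (wiener f g (AN T N a) l)) ∂circ := by
    rw [H.root.integral_form hu hu, inner_self_eq_norm_sq_to_K]
    push_cast
    rfl
  have e2 : ((‖(memLp_functional hζ N a).toLp‖ ^ 2 : ℝ) : ℂ) =
      inner ℂ (memLp_functional hζ N a).toLp (memLp_functional hζ N a).toLp := by
    rw [inner_self_eq_norm_sq_to_K]
    push_cast
    rfl
  have e3 : ∀ l, AN T N a l ⬝ᵥ (f l *ᵥ star (AN T N a l)) =
      ∑ j ∈ Finset.range N, ∑ μ,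
        star (avec T a j μ) * ((AN T N a l ᵥ* f l) μ * expi (-j) l) := by
    intro l
    rw [Matrix.dotProduct_mulVec, Finset.sum_comm, dotProduct]
    refine Finset.sum_congr rfl fun μ _ => ?_
    rw [Pi.star_apply, AN, star_sum, Finset.mul_sum]
    refine Finset.sum_congr rfl fun j _ => ?_
    rw [star_mul', star_expi]
    ring
  rw [e1, hD, ← integral_add (H.root.integrable_form hu hu) i3, e2, inner_functional_right hζ]
  trans ∫ l, AN T N a l ⬝ᵥ (f l *ᵥ star (AN T N a l)) ∂circ
  · simp_rw [e3]
    rw [integral_finsetSum _ fun j _ => integrable_finsetSum _ fun μ _ => hi j μ]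
    -- conjugating the pairings turns the double sum into the variance
    have h2 := congrArg (starRingEnd ℂ) (inner_functional_right hζ N a
      (memLp_functional hζ N a).toLp)
    rw [inner_conj_symm, map_sum] at h2
    rw [← inner_functional_right hζ, h2]
    refine Finset.sum_congr rfl fun j _ => ?_
    rw [map_sum, integral_finsetSum _ fun μ _ => hi j μ]
    refine Finset.sum_congr rfl fun μ _ => ?_
    rw [map_mul, inner_conj_symm, inner_block_functional hζ hf H, integral_const_mul]
    rfl
  · refine integral_congr_ae ?_
    filter_upwards [H.posSemidef_left, H.posSemidef_right, H.isUnit_det] with l hf hg hl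
    rw [dotProduct_parallelSum hf.1 hg.1 hl, wiener]
    ring

theorem span_observed_eq (hζ : IsPC P T ζ) (hθ : IsPC P T θ) (hT : 0 < T) (s : ℕ)
    (Nobs Kmis : ℕ → ℕ) :
    Submodule.span ℂ ((fun j => ((hζ.memLp j).add (hθ.memLp j)).toLp) '' observed T s Nobs Kmis) =
      combSpan (obs hζ hθ) (observedBlocks s Nobs Kmis) := by
  apply le_antisymm
  · rw [Submodule.span_le]
    rintro _ ⟨j, hj, rfl⟩
    obtain ⟨n, ν, rfl⟩ := exists_block_index hT j
    exact apply_mem_combSpan (obs hζ hθ) ((mem_observed_iff T s Nobs Kmis n ν).1 hj) ν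
  · rintro _ ⟨p, hp, rfl⟩
    rw [comb_apply]
    refine Submodule.sum_mem _ fun j hj => Submodule.sum_mem _ fun ν _ => Submodule.smul_mem _ _ ?_
    exact Submodule.subset_span ⟨_, (mem_observed_iff T s Nobs Kmis j ν).2 (hp hj), rfl⟩

/-- Linear estimates are the elements of the closed span of the observations. -/
theorem isLinearEstimate_iff (hζ : IsPC P T ζ) (hθ : IsPC P T θ) (hT : 0 < T) (s : ℕ)
    (Nobs Kmis : ℕ → ℕ) {X : Ω → ℂ} :
    IsLinearEstimate P ζ θ (observed T s Nobs Kmis) X ↔ ∃ hX : MemLp X 2 P,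
      hX.toLp ∈ (combSpan (obs hζ hθ) (observedBlocks s Nobs Kmis)).topologicalClosure := by
  rw [IsLinearEstimate, ← exists_prop]
  refine exists_congr fun hX => ?_
  have hd : ∀ p : ℤ →₀ ℂ, eLpNorm (fun ω => X ω - ∑ j ∈ p.support, p j * (ζ j ω + θ j ω)) 2 P =
      edist hX.toLp (∑ j ∈ p.support, p j • ((hζ.memLp j).add (hθ.memLp j)).toLp) := fun p =>
    (edist_toLp_sum hX (fun j => (hζ.memLp j).add (hθ.memLp j)) p.support p).symm
  simp_rw [hd]
  rw [← span_observed_eq hζ hθ hT, ← SetLike.mem_coe, Submodule.topologicalClosure_coe,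
    EMetric.mem_closure_iff]
  constructor
  · intro h ε hε
    obtain ⟨δ, hδ, hδε⟩ := exists_between hε
    obtain ⟨p, hp, hpe⟩ := h δ hδ
    exact ⟨_, Submodule.sum_mem _ fun j hj => Submodule.smul_mem _ _
      (Submodule.subset_span ⟨j, hp hj, rfl⟩), hpe.trans_lt hδε⟩
  · intro h ε hε
    obtain ⟨y, hy, hye⟩ := h ε hε
    obtain ⟨p, hp, rfl⟩ := (Finsupp.mem_span_image_iff_linearCombination ℂ).1 hy
    exact ⟨p, hp, hye.le⟩

end prob

/-! ### The optimal estimate -/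

/-- The hypotheses of the theorem provide a density pair, with `f + g` bounded as `B` is
invertible. -/
theorem exists_isDensityPair {Ω : Type*} [MeasurableSpace Ω] {P : Measure Ω} {ζ θ : ℤ → Ω → ℂ}
    {f g : ℝ → Matrix (Fin T) (Fin T) ℂ} {G : Set ℤ} (hf : IsSpectralDensity P T ζ f)
    (hg : IsSpectralDensity P T θ g) (hmin : Minimality f g) (hG : Set.Ici 0 ⊆ G)
    (hB : BInvertible f g G) : ∃ S M, IsDensityPair f g S M := by
  have hm : ∀ ν μ, AEStronglyMeasurable (fun l => (f l + g l) ν μ) circ := fun ν μ =>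
    (hf.integrable ν μ).1.add (hg.integrable ν μ).1
  have hp : ∀ᵐ l ∂circ, (f l + g l).PosSemidef := by
    filter_upwards [hf.posSemidef, hg.posSemidef] with l h1 h2 using h1.add h2
  obtain ⟨S, hS⟩ := exists_isRoot hm hp hmin.1
  have hint := integrable_of_trace (aestronglyMeasurable_inv hm) (hp.mono fun l h => h.inv) hmin.2
  obtain ⟨M, hM, hle⟩ := exists_norm_vecMul_root_le hS hint hG hB
  exact ⟨S, M, hS, hf.posSemidef, hg.posSemidef, hmin.1, hf.integrable, hg.integrable, hint, hM,
    hle⟩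

/-- Given that `X` is at the same distance from every `∑ p_ν(j) (ζ_ν(j) + θ_ν(j))` as `h` is from
the trigonometric polynomial of `p`, the functions which are spectral characteristics of `X` are
exactly those equal to `h` almost everywhere. -/
theorem isSpectralCharacteristic_iff {Ω : Type*} [MeasurableSpace Ω] {P : Measure Ω}
    {ζ θ : ℤ → Ω → ℂ} (hζ : IsPC P T ζ) (hθ : IsPC P T θ)
    {f g S : ℝ → Matrix (Fin T) (Fin T) ℂ} {M : ℝ} (H : IsDensityPair f g S M) {O : Set ℤ}
    {h : ℝ → Fin T → ℂ} (hL : MemL2s (fun l => f l + g l) O h) (hh : MemLp (emb S h) 2 circ)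
    {X : Ω → ℂ} (hX : MemLp X 2 P)
    (hiso : ∀ p, ‖hX.toLp - comb (obs hζ hθ) p‖ = ‖hh.toLp - comb H.expEmb p‖)
    (h' : ℝ → Fin T → ℂ) :
    IsSpectralCharacteristic P ζ θ (fun l => f l + g l) O h' X ↔ h' =ᵐ[circ] h := by
  have hiso' : ∀ p, eLpNorm (fun ω => X ω - randPoly ζ θ p ω) 2 P =
      edist hh.toLp (comb H.expEmb p) := by
    intro p
    obtain ⟨h1, h2⟩ := toLp_comb (fun j ν => (hζ.memLp_block j ν).add (hθ.memLp_block j ν)) p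
    have h3 : comb (obs hζ hθ) p = h1.toLp := h2.symm
    rw [edist_dist, dist_eq_norm, ← hiso, ← dist_eq_norm, ← edist_dist, h3, Lp.edist_toLp_toLp,
      randPoly_eq_comb]
    rfl
  constructor
  · rintro ⟨hL', -, hs⟩
    obtain ⟨hm', hh', -⟩ := H.memL2s_iff.1 hL'
    have : hh'.toLp = hh.toLp := by
      rw [← edist_le_zero]
      refine le_of_forall_pos_le_add fun ε hε => ?_
      have hε2 : 0 < ε / 2 := ENNReal.half_pos hε.ne'
      obtain ⟨p, hp1, hp2⟩ := hs (min (ε / 2) ((ε / 2) ^ 2)) (lt_min hε2 (by positivity))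
      rw [H.energy_sub_trigPoly hh'] at hp1
      rw [hiso'] at hp2
      have hp1' := (ENNReal.pow_le_pow_left_iff two_ne_zero).1 (hp1.trans (min_le_right _ _))
      calc edist hh'.toLp hh.toLp
          ≤ edist hh'.toLp (comb H.expEmb p) + edist hh.toLp (comb H.expEmb p) :=
            edist_triangle_right _ _ _
        _ ≤ ε / 2 + ε / 2 := add_le_add hp1' (hp2.trans (min_le_left _ _))
        _ = 0 + ε := by rw [ENNReal.add_halves, zero_add]
    refine H.root.ae_eq_of_emb_ae_eq ?_
    exact hh'.coeFn_toLp.symm.trans (this ▸ hh.coeFn_toLp)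
  · intro hae
    have hen : ∀ p : ℤ →₀ (Fin T → ℂ), energy (fun l => f l + g l) (fun l => h' l - trigPoly p l) =
        edist hh.toLp (comb H.expEmb p) ^ 2 := by
      intro p
      rw [← H.energy_sub_trigPoly hh]
      refine lintegral_congr_ae ?_
      filter_upwards [hae] with l hl
      rw [hl]
    have hL2 := hL.2
    simp_rw [H.energy_sub_trigPoly hh] at hL2
    refine ⟨⟨fun ν => (hL.1 ν).congr (hae.symm.fun_comp fun v => v ν), fun ε hε => ?_⟩,
      hX, fun ε hε => ?_⟩
    · simp_rw [hen]
      exact hL2 ε hε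
    · simp_rw [hen, hiso']
      obtain ⟨p, -, hp⟩ := hL2 (min ε (ε ^ 2)) (lt_min hε (by positivity))
      exact ⟨p, hp.trans (min_le_left _ _),
        (ENNReal.pow_le_pow_left_iff two_ne_zero).1 (hp.trans (min_le_right _ _))⟩

end PCExtrapolation

theorem mainTheorem2 {Ω : Type*} [MeasurableSpace Ω] (P : Measure Ω) [IsProbabilityMeasure P]
    (T : ℕ) (hT : 0 < T) (s : ℕ) (Nobs Kmis : ℕ → ℕ) (N : ℕ) (a : ℕ → ℂ)
    (ζ θ : ℤ → Ω → ℂ) (hζ : IsPC P T ζ) (hθ : IsPC P T θ) (hunc : Uncorrelated P ζ θ)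
    (f g : ℝ → Matrix (Fin T) (Fin T) ℂ)
    (hf : IsSpectralDensity P T ζ f) (hg : IsSpectralDensity P T θ g)
    (hmin : Minimality f g) (hB : BInvertible f g (Gam s Nobs Kmis)) :
    ∃ (r c : Seq2 T (Gam s Nobs Kmis)) (C : ℝ → Fin T → ℂ),
      -- `r = R_N a_N`, `c = B⁻¹ r`, `C(e^{iλ}) = ∑ c(n) e^{inλ}`
      (∀ k ν, r k ν = RNaN f g N a k ν) ∧
      (c, r) ∈ Bgraph f g (Gam s Nobs Kmis) ∧
      IsSeries c C ∧
      -- `h_N` minimises the mean-square error in the spectral domain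
      MemL2s (fun l => f l + g l) (observedBlocks s Nobs Kmis) (hN f g N a C) ∧
      (∀ h, MemL2s (fun l => f l + g l) (observedBlocks s Nobs Kmis) h →
        mse f g (AN T N a) (hN f g N a C) ≤ mse f g (AN T N a) h) ∧
      (mse f g (AN T N a) (hN f g N a C) : ℂ) = DNform f g N a + inner ℂ c r ∧
      -- the optimal estimate exists, has spectral characteristic `h_N`, and the stated error
      (∃ X, IsOptimalEstimate P ζ θ (observed T s Nobs Kmis) (functional T N a ζ) X) ∧
      ∀ X, IsOptimalEstimate P ζ θ (observed T s Nobs Kmis) (functional T N a ζ) X →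
        (∀ h, IsSpectralCharacteristic P ζ θ (fun l => f l + g l) (observedBlocks s Nobs Kmis) h X ↔
          h =ᵐ[circ] hN f g N a C) ∧
        ((∫ ω, ‖functional T N a ζ ω - X ω‖ ^ 2 ∂P : ℝ) : ℂ) = DNform f g N a + inner ℂ c r := by
  obtain ⟨S, M, H⟩ := exists_isDensityPair hf hg hmin (fun n hn => Or.inr hn) hB
  obtain ⟨r, hr⟩ := exists_fourierSeq (Gam s Nobs Kmis) (H.memLp_wiener_AN N a)
  have hrR : ∀ k ν, r k ν = RNaN f g N a k ν := fun k ν => by rw [hr, H.RNaN_eq]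
  obtain ⟨c, hc, -⟩ := hB r
  obtain ⟨C, hs, he, hq⟩ := id hc
  have hC := hs.memLp_emb H.root.inv he
  have hmem := H.toLp_emb_hN_mem (compl_Gam s Nobs Kmis) N a hrR hC hq
  set hh := H.memLp_emb_hN N a hC
  set u := (H.memLp_emb_AN N a).toLp
  have hNm : ∀ ν, AEStronglyMeasurable (fun l => hN f g N a C l ν) circ := fun ν => by
    rw [hN_eq]
    exact (H.memLp_wiener_AN N a ν).1.sub
      (aestronglyMeasurable_vecMul (fun ν μ => (H.integrable_inv ν μ).1) (fun ν => (hs ν).1.1) ν)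
  have hL : MemL2s (fun l => f l + g l) (observedBlocks s Nobs Kmis) (hN f g N a C) :=
    H.memL2s_iff.2 ⟨hNm, hh, hmem⟩
  have hdiff : u - hh.toLp = hC.toLp := by
    rw [H.toLp_emb_hN N a hC, sub_sub_cancel]
  have horth : u - hh.toLp ∈ (combSpan H.expEmb (observedBlocks s Nobs Kmis))ᗮ := by
    rw [hdiff, mem_combSpan_orthogonal]
    intro j hj ν
    rw [← compl_Gam] at hj
    exact H.inner_expEmb_series hs hC hj ν
  have hBc : ((‖u - hh.toLp‖ ^ 2 : ℝ) : ℂ) = inner ℂ c r := by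
    rw [hdiff, ← hq c C hs he, Bform_eq_inner H.root hC hC, inner_self_eq_norm_sq_to_K]
    push_cast
    rfl
  -- `⟨D_N a_N, a_N⟩` is real, being the difference of two squared norms
  obtain ⟨D, hD, hDN⟩ : ∃ D : ℝ, ‖(memLp_functional hζ N a).toLp‖ ^ 2 = ‖u‖ ^ 2 + D ∧
      DNform f g N a = D := by
    refine ⟨_, (add_sub_cancel _ _).symm, ?_⟩
    rw [Complex.ofReal_sub, norm_functional_sq hζ hf H, add_sub_cancel_left]
  obtain ⟨Y, hYmem, hYorth, hYerr, hYiso⟩ := exists_transfer (inner_obs hζ hθ hunc hf hg H)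
    (inner_obs_functional hζ hθ hunc hf H N a) hD hmem horth
  have hY : MemLp (Y : Ω → ℂ) 2 P := Lp.memLp Y
  have hYtoLp : hY.toLp = Y := Lp.toLp_coeFn Y hY
  have hlin : IsLinearEstimate P ζ θ (observed T s Nobs Kmis) Y :=
    (isLinearEstimate_iff hζ hθ hT s Nobs Kmis).2 ⟨hY, by rwa [hYtoLp]⟩
  refine ⟨r, c, C, hrR, hc, hs, hL, fun h hhL => ?_, ?_, ⟨Y, hlin, fun X' hX' => ?_⟩,
    fun X hX => ?_⟩
  · obtain ⟨hm', hh', hmem'⟩ := H.memL2s_iff.1 hhL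
    have h1 := H.mse_eq N a hNm hh
    have h2 := H.mse_eq N a hm' hh'
    rw [hDN, ← Complex.ofReal_add, Complex.ofReal_inj] at h1 h2
    have h3 := norm_sub_sq_of_mem_orthogonal hmem hmem' horth
    rw [norm_sub_rev] at h1 h2
    rw [h1, h2, h3]
    linarith [sq_nonneg ‖hh.toLp - hh'.toLp‖]
  · rw [H.mse_eq N a hNm hh, norm_sub_rev, hBc, add_comm]
  · obtain ⟨hXm, hXmem⟩ := (isLinearEstimate_iff hζ hθ hT s Nobs Kmis).1 hX'
    rw [← norm_toLp_sub_sq hY (memLp_functional hζ N a),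
      ← norm_toLp_sub_sq hXm (memLp_functional hζ N a), hYtoLp,
      norm_sub_sq_of_mem_orthogonal hYmem hXmem hYorth]
    linarith [sq_nonneg ‖Y - hXm.toLp‖]
  · obtain ⟨hXm, hXmem⟩ := (isLinearEstimate_iff hζ hθ hT s Nobs Kmis).1 hX.1
    -- both `X` and the projection `Y` are optimal, hence equal
    have h1 := hX.2 Y hlin
    rw [← norm_toLp_sub_sq hY (memLp_functional hζ N a),
      ← norm_toLp_sub_sq hXm (memLp_functional hζ N a), hYtoLp,
      norm_sub_sq_of_mem_orthogonal hYmem hXmem hYorth] at h1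
    have hXY : Y = hXm.toLp := by
      rw [← sub_eq_zero, ← norm_eq_zero]
      exact pow_eq_zero_iff two_ne_zero |>.1 (le_antisymm (by linarith) (sq_nonneg _))
    refine ⟨isSpectralCharacteristic_iff hζ hθ H hL hh hXm (hXY ▸ hYiso), ?_⟩
    rw [← norm_toLp_sub_sq hXm (memLp_functional hζ N a), ← hXY, hYerr, Complex.ofReal_add, hBc,
      hDN, add_comm]
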